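/- There is a universal constant $C>0$ such that the following holds for every real $\theta>1$. The equation $1-e^{-\theta x}=x$ has a unique positive solution $\beta=\beta(\theta)$, and there is a constant $c=c(\theta)>0$, depending only on $\theta$, such that for every integer $m\ge 1$ with $\theta/m\le 1$ and every real $A>0$, $$\mathbb{P}\Big(\big||\mathcal{C}_1|-\beta m\big|\ge A\sqrt{m}\Big)\le C e^{-cA^2}.$$ Here $\mathcal{C}_1$ is a largest connected component of the random graph $G(m,\theta/m)$, obtained from the complete graph on $m$ vertices by retaining each edge independently with probability $\theta/m$ and deleting it otherwise, and $|\mathcal{C}_1|$ is its number of vertices. -/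

import Mathlib

open MeasureTheory

/-- The number of vertices of a largest connected component of a finite graph. -/
noncomputable def largestComponentCard {V : Type*} [Finite V] (G : SimpleGraph V) : ℕ :=
  ⨆ K : G.ConnectedComponent, K.supp.ncard

/-! Explore the graph from a root set `R` of size `r`. If the reached set is a given `S` with `k`
elements, then each vertex of `S \ R` is joined to `S` and no edge leaves `S`; `reachProb_le` bounds
the probability as if these were independent events of probability `q = 1 - (1 - p) ^ k` and `1 -
q`. A union bound over `S` gives `reachBound`, which is essentially the probability that a binomial
variable with parameters `m` and `q` equals `k`.

With `x = k / m`, such a probability is at most of order `exp (-m (x - q) ^ 2 / 2)`. For `p = θ /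
m`, `q - x` is within `O(1 / m)` of `f x = 1 - exp (-θ x) - x`. This function is strictly concave
and vanishes at `0` and `β`, so for `x ≥ δ > 0` it is at least a constant times `|x - β|` in
absolute value. Hence the probabilities decay like `exp (-c m (x - β) ^ 2)`.

Sizes above `δ m` are treated by single roots: a largest component of size `k` contains `k` vertices
that each reach exactly `k` vertices. Stirling's factor `1 / √m` makes the sum over `k` a Gaussian
tail in `A`. If every component has at most `δ m` vertices, adding roots one by one makes the
reached set grow in steps of at most `δ m`, so for some root set its size falls in a window between
`δ m` and `2 δ m`, where the same estimate is exponentially small in `m`.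

The resulting prefactor depends on `θ`; since probabilities are at most `1`, lowering the rate
replaces it by `2`. -/

namespace SimpleGraph

/-! ### Reachable sets and the removal of one vertex -/

variable {V W : Type*}

/-- The set of vertices reachable in `G` from some vertex of `R`. -/
def reachSet (G : SimpleGraph V) (R : Set V) : Set V := {v | ∃ u ∈ R, G.Reachable u v}

lemma subset_reachSet (G : SimpleGraph V) (R : Set V) : R ⊆ G.reachSet R :=
  fun v hv => ⟨v, hv, Reachable.refl v⟩

lemma mem_reachSet_of_adj {G : SimpleGraph V} {R : Set V} {u v : V} (hu : u ∈ G.reachSet R)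
    (h : G.Adj u v) : v ∈ G.reachSet R := by
  obtain ⟨w, hw, hwu⟩ := hu
  exact ⟨w, hw, hwu.trans h.reachable⟩

lemma reachSet_subset {G : SimpleGraph V} {R T : Set V} (hR : R ⊆ T)
    (hT : ∀ u ∈ T, ∀ v, G.Adj u v → v ∈ T) : G.reachSet R ⊆ T := by
  rintro v ⟨u, hu, ⟨p⟩⟩
  have hu' := hR hu
  clear hu
  induction p with
  | nil => exact hu'
  | cons h _ ih => exact ih (hT _ hu' _ h)

lemma reachSet_union (G : SimpleGraph V) (R T : Set V) :
    G.reachSet (R ∪ T) = G.reachSet R ∪ G.reachSet T := by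
  ext v
  simp only [reachSet, Set.mem_union, Set.mem_ofPred_eq]
  grind

@[simp] lemma reachSet_empty (G : SimpleGraph V) : G.reachSet ∅ = ∅ := by
  simp [reachSet]

lemma reachSet_simpleGraph (e : V ≃ W) (G : SimpleGraph V) (R : Set V) :
    (e.simpleGraph G).reachSet (e '' R) = e '' G.reachSet R := by
  apply Set.Subset.antisymm
  · apply reachSet_subset (Set.image_mono (subset_reachSet G R))
    rintro _ ⟨u, hu, rfl⟩ v hv
    refine ⟨e.symm v, mem_reachSet_of_adj hu ?_, by simp⟩
    simpa [Equiv.simpleGraph] using hv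
  · rintro _ ⟨v, ⟨u, hu, huv⟩, rfl⟩
    refine ⟨e u, ⟨u, hu, rfl⟩, ?_⟩
    refine huv.map (⟨e, ?_⟩ : G →g e.simpleGraph G)
    intro a b hab
    simpa [Equiv.simpleGraph] using hab

/-- The graph obtained from `H` by adding a vertex `none` adjacent to the vertices in `N`. -/
def addVertex (H : SimpleGraph W) (N : Set W) : SimpleGraph (Option W) where
  Adj
    | none, none => False
    | none, some w => w ∈ N
    | some w, none => w ∈ N
    | some u, some v => H.Adj u v
  symm := ⟨by
    rintro (_ | u) (_ | v) h
    · exact h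
    · exact h
    · exact h
    · exact SimpleGraph.Adj.symm h⟩
  loopless := ⟨by
    rintro (_ | u) h
    · exact h
    · exact H.loopless.irrefl _ h⟩

@[simp] lemma addVertex_adj_none_some {H : SimpleGraph W} {N : Set W} {w : W} :
    (H.addVertex N).Adj none (some w) ↔ w ∈ N := Iff.rfl

@[simp] lemma addVertex_adj_some_none {H : SimpleGraph W} {N : Set W} {w : W} :
    (H.addVertex N).Adj (some w) none ↔ w ∈ N := Iff.rfl

@[simp] lemma addVertex_adj_some_some {H : SimpleGraph W} {N : Set W} {u v : W} :
    (H.addVertex N).Adj (some u) (some v) ↔ H.Adj u v := Iff.rfl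

/-- A root only passes its status on to its neighbours, so it can be deleted if they are made roots.
This is the recursion behind the exploration bound. -/
lemma reachSet_addVertex (H : SimpleGraph W) (N : Set W) {R : Set (Option W)} (hR : none ∈ R) :
    (H.addVertex N).reachSet R = insert none (some '' H.reachSet (some ⁻¹' R ∪ N)) := by
  apply Set.Subset.antisymm
  · apply reachSet_subset
    · rintro (_ | w) hw
      · simp
      · exact Or.inr ⟨w, subset_reachSet _ _ (Or.inl hw), rfl⟩
    · rintro (_ | u) hu (_ | v) h
      · simp
      · exact Or.inr ⟨v, subset_reachSet _ _ (Or.inr h), rfl⟩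
      · simp
      · simp only [Set.mem_insert_iff, reduceCtorEq, Set.mem_image, Option.some.injEq,
          exists_eq_right, false_or] at hu ⊢
        exact mem_reachSet_of_adj hu h
  · rintro _ (rfl | ⟨v, ⟨u, hu, huv⟩, rfl⟩)
    · exact subset_reachSet _ _ hR
    · have h1 : (H.addVertex N).Reachable (some u) (some v) :=
        huv.map (⟨some, fun h => h⟩ : H →g H.addVertex N)
      rcases hu with hu | hu
      · exact ⟨some u, hu, h1⟩
      · exact ⟨none, hR, Reachable.trans (Adj.reachable (by exact hu)) h1⟩

/-- Graphs on `Option W` correspond to a graph on `W` and a set of neighbours of `none`. -/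
def optionEquiv (W : Type*) : SimpleGraph W × Set W ≃ SimpleGraph (Option W) where
  toFun x := x.1.addVertex x.2
  invFun G := (G.comap some, {w | G.Adj none (some w)})
  left_inv x := by
    ext <;> simp
  right_inv G := by
    ext (_ | u) (_ | v) <;> simp [G.adj_comm]

lemma ncard_edgeSet_addVertex [Finite W] (H : SimpleGraph W) (N : Set W) :
    (H.addVertex N).edgeSet.ncard = H.edgeSet.ncard + N.ncard := by
  have h : (H.addVertex N).edgeSet =
      Sym2.map some '' H.edgeSet ∪ (fun w => s(none, some w)) '' N := by
    ext e
    induction e with | h a b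
    simp only [mem_edgeSet, Set.mem_union, Set.mem_image]
    rcases a with _ | a <;> rcases b with _ | b
    · simp [Sym2.exists]
    · simp [Sym2.exists]
    · simp [Sym2.exists]
    · simp only [addVertex_adj_some_some, Sym2.exists, mem_edgeSet, Sym2.map_mk, Sym2.eq_iff]
      simp only [Option.some.injEq, reduceCtorEq, false_and, and_false, or_self]
      constructor
      · exact fun h => Or.inl ⟨a, b, h, Or.inl ⟨rfl, rfl⟩⟩
      · rintro (⟨x, y, h, ⟨rfl, rfl⟩ | ⟨rfl, rfl⟩⟩ | ⟨_, h⟩)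
        · exact h
        · exact h.symm
        · exact h.elim
  rw [h, Set.ncard_union_eq, Set.ncard_image_of_injective, Set.ncard_image_of_injective]
  · intro a b; simp
  · exact Sym2.map.injective (Option.some_injective _)
  · rw [Set.disjoint_left]
    rintro _ ⟨e, _, rfl⟩ ⟨w, _, h⟩
    have : (none : Option W) ∈ Sym2.map some e := by rw [← h]; simp
    simp [Sym2.mem_map] at this

lemma ncard_edgeSet_simpleGraph [Finite V] (e : V ≃ W) (G : SimpleGraph V) :
    (e.simpleGraph G).edgeSet.ncard = G.edgeSet.ncard := by
  have : G ≃g e.simpleGraph G := ⟨e, by intro a b; simp [Equiv.simpleGraph]⟩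
  exact (Nat.card_congr this.mapEdgeSet).symm

lemma ncard_edgeSet_le [Finite V] (G : SimpleGraph V) :
    G.edgeSet.ncard ≤ (Nat.card V).choose 2 := by
  classical
  cases nonempty_fintype V
  rw [Set.ncard_eq_toFinset_card', Nat.card_eq_fintype_card]
  exact card_edgeFinset_le_card_choose_two

/-! ### The binomial random graph as a weighted sum over graphs -/

/-- The probability of the graph `G` in the binomial random graph with edge probability `p`. -/
noncomputable def weight (p : ℝ) (G : SimpleGraph V) : ℝ :=
  p ^ G.edgeSet.ncard * (1 - p) ^ ((Nat.card V).choose 2 - G.edgeSet.ncard)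

lemma weight_nonneg {p : ℝ} (hp0 : 0 ≤ p) (hp1 : p ≤ 1) (G : SimpleGraph V) : 0 ≤ weight p G :=
  mul_nonneg (pow_nonneg hp0 _) (pow_nonneg (by linarith) _)

lemma weight_addVertex [Finite W] (p : ℝ) (H : SimpleGraph W) (N : Set W) :
    weight p (H.addVertex N) =
      weight p H * (p ^ N.ncard * (1 - p) ^ (Nat.card W - N.ncard)) := by
  have h1 := ncard_edgeSet_le H
  have h2 : N.ncard ≤ Nat.card W := Set.ncard_le_card N
  have h3 : (Nat.card (Option W)).choose 2 - (H.edgeSet.ncard + N.ncard) =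
      ((Nat.card W).choose 2 - H.edgeSet.ncard) + (Nat.card W - N.ncard) := by
    rw [Finite.card_option, Nat.choose_succ_succ' _ 1, Nat.choose_one_right, one_add_one_eq_two]
    omega
  rw [weight, weight, ncard_edgeSet_addVertex, h3]
  ring

lemma weight_simpleGraph [Finite V] (p : ℝ) (e : V ≃ W) (G : SimpleGraph V) :
    weight p (e.simpleGraph G) = weight p G := by
  rw [weight, weight, ncard_edgeSet_simpleGraph, Nat.card_congr e]

lemma binomialRandom_real_singleton [Finite V] (p : unitInterval) (G : SimpleGraph V) :
    (binomialRandom V p).real {G} = weight p G := by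
  simp [measureReal_def, binomialRandom_singleton, weight]

instance [Finite V] : MeasurableSingletonClass (SimpleGraph V) := ⟨fun G => by
  rw [show ({G} : Set (SimpleGraph V)) = edgeSet ⁻¹' {G.edgeSet} by ext; simp]
  exact measurable_edgeSet (measurableSet_singleton _)⟩

open scoped Classical in
lemma binomialRandom_real_eq_sum [Fintype V] (p : unitInterval) (E : Set (SimpleGraph V)) :
    (binomialRandom V p).real E = ∑ G : SimpleGraph V, if G ∈ E then weight p G else 0 := by
  rw [← Finset.sum_filter]
  simp_rw [← binomialRandom_real_singleton]
  rw [sum_measureReal_singleton]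
  simp

/-! ### The exploration bound -/

open scoped Classical in
/-- The probability that the set of vertices reachable from `R` is exactly `S`. -/
noncomputable def reachProb [Fintype V] (p : ℝ) (R S : Set V) : ℝ :=
  ∑ G : SimpleGraph V, if G.reachSet R = S then weight p G else 0

lemma binomialRandom_real_reachSet_eq [Fintype V] (p : unitInterval) (R S : Set V) :
    (binomialRandom V p).real {G | G.reachSet R = S} = reachProb (p : ℝ) R S :=
  binomialRandom_real_eq_sum p _

lemma reachProb_image [Fintype V] [Fintype W] (p : ℝ) (e : V ≃ W) (R S : Set V) :
    reachProb p (e '' R) (e '' S) = reachProb p R S := by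
  classical
  unfold reachProb
  rw [← Equiv.sum_comp e.simpleGraph]
  simp_rw [reachSet_simpleGraph, weight_simpleGraph, e.injective.image_injective.eq_iff]

lemma reachProb_of_not_subset [Fintype V] (p : ℝ) {R S : Set V} (h : ¬ R ⊆ S) :
    reachProb p R S = 0 := by
  apply Finset.sum_eq_zero
  intro G _
  rw [if_neg]
  rintro rfl
  exact h (subset_reachSet G R)

/-- The edges at the root `none` are independent of the rest of the graph; the sum conditions on its
neighbourhood `N` and then deletes it by `reachSet_addVertex`. -/
lemma reachProb_option [Fintype W] (p : ℝ) {R S : Set (Option W)} (hR : none ∈ R)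
    (hS : none ∈ S) :
    reachProb p R S = ∑ N : Finset W, p ^ N.card * (1 - p) ^ (Fintype.card W - N.card) *
      reachProb p (some ⁻¹' R ∪ (N : Set W)) (some ⁻¹' S) := by
  classical
  unfold reachProb
  have key : ∀ (H : SimpleGraph W) (N : Set W), (H.addVertex N).reachSet R = S ↔
      H.reachSet (some ⁻¹' R ∪ N) = some ⁻¹' S := by
    intro H N
    rw [reachSet_addVertex H N hR]
    constructor
    · rintro rfl
      ext w; simp
    · intro h
      rw [h]
      ext (_ | w) <;> simp [hS]
  have h1 := Fintype.sum_equiv (optionEquiv W) (fun x => if (x.1.addVertex x.2).reachSet R = S then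
      weight p (x.1.addVertex x.2) else 0) (fun G => if G.reachSet R = S then weight p G else 0)
      (fun _ => rfl)
  have h2 := Fintype.sum_equiv (Fintype.finsetEquivSet (α := W)) (fun N => ∑ H : SimpleGraph W,
      if (H.addVertex N).reachSet R = S then weight p (H.addVertex N) else 0)
    (fun N : Set W => ∑ H : SimpleGraph W,
      if (H.addVertex N).reachSet R = S then weight p (H.addVertex N) else 0) (fun _ => rfl)
  rw [Fintype.sum_prod_type_right] at h1
  refine Eq.trans (by congr!) ((h2.trans h1).symm.trans ?_)
  apply Finset.sum_congr rfl
  intro N _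
  rw [Finset.mul_sum]
  apply Finset.sum_congr rfl
  intro H _
  simp only [key]
  split_ifs
  · rw [weight_addVertex, Set.ncard_coe_finset, Nat.card_eq_fintype_card]
    ring
  · simp

/-- The sum is a product over the vertices of `B`: one in `A` contributes `p + (1 - p) = 1`, any
other contributes `p` if it lies in `N` and `(1 - p) * a` if not. The `w - B.card` vertices outside
`B` must all avoid `N`. -/
lemma sum_powerset_mul_pow_card_sdiff [DecidableEq W] (A B : Finset W) {w : ℕ} (hB : B.card ≤ w)
    (p a : ℝ) :
    ∑ N ∈ B.powerset, p ^ N.card * (1 - p) ^ (w - N.card) * a ^ (B \ (A ∪ N)).card =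
      (1 - p) ^ (w - B.card) * (p + (1 - p) * a) ^ (B \ A).card := by
  have h1 : (p + (1 - p) * a) ^ (B \ A).card =
      ∏ v ∈ B, (p + (1 - p) * if v ∈ A then 1 else a) := by
    rw [← Finset.prod_sdiff (Finset.inter_subset_left : B ∩ A ⊆ B), Finset.sdiff_inter_self_left]
    rw [Finset.prod_congr rfl (g := fun _ => p + (1 - p) * a), Finset.prod_const,
      Finset.prod_eq_one, mul_one]
    · intro v hv
      rw [if_pos (Finset.mem_inter.1 hv).2]; ring
    · intro v hv
      rw [if_neg (Finset.mem_sdiff.1 hv).2]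
  rw [h1, Finset.prod_add, Finset.mul_sum]
  apply Finset.sum_congr rfl
  intro N hN
  have hNB := Finset.mem_powerset.1 hN
  have h2 : w - N.card = (w - B.card) + (B \ N).card := by
    have := Finset.card_le_card hNB
    rw [Finset.card_sdiff_of_subset hNB]; omega
  have h3 : a ^ (B \ (A ∪ N)).card = ∏ v ∈ B \ N, if v ∈ A then 1 else a := by
    rw [Finset.prod_ite, Finset.prod_const_one, one_mul, Finset.prod_const]
    congr 2
    ext v
    simp only [Finset.mem_sdiff, Finset.mem_union, Finset.mem_filter]
    tauto
  rw [Finset.prod_const, Finset.prod_mul_distrib, Finset.prod_const, h2, h3, pow_add]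
  ring

lemma reachProb_le_option [Fintype W] {p : ℝ} (hp0 : 0 ≤ p) (hp1 : p ≤ 1)
    (ih : ∀ R S : Set W, reachProb p R S ≤
      (1 - (1 - p) ^ S.ncard) ^ (S \ R).ncard * ((1 - p) ^ S.ncard) ^ (Fintype.card W - S.ncard))
    {R S : Set (Option W)} (hR : none ∈ R) (hS : none ∈ S) :
    reachProb p R S ≤ (1 - (1 - p) ^ S.ncard) ^ (S \ R).ncard *
      ((1 - p) ^ S.ncard) ^ (Fintype.card (Option W) - S.ncard) := by
  classical
  set A : Finset W := (some ⁻¹' R).toFinset with hA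
  set B : Finset W := (some ⁻¹' S).toFinset with hB
  have hA' : some ⁻¹' R = (A : Set W) := by simp [hA]
  have hB' : some ⁻¹' S = (B : Set W) := by simp [hB]
  have hBw : B.card ≤ Fintype.card W := B.card_le_univ
  have hScard : S.ncard = B.card + 1 := by
    have : S = insert none (some '' (B : Set W)) := by
      rw [← hB']; ext (_ | w) <;> simp [hS]
    rw [this, Set.ncard_insert_of_notMem (by simp),
      Set.ncard_image_of_injective _ (Option.some_injective _), Set.ncard_coe_finset]
  have hSRcard : (S \ R).ncard = (B \ A).card := by
    have : S \ R = some '' ((B \ A : Finset W) : Set W) := by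
      rw [Finset.coe_sdiff, ← hA', ← hB']; ext (_ | w) <;> simp [hR]
    rw [this, Set.ncard_image_of_injective _ (Option.some_injective _), Set.ncard_coe_finset]
  set a : ℝ := 1 - (1 - p) ^ B.card with ha
  have hterm : ∀ N : Finset W, p ^ N.card * (1 - p) ^ (Fintype.card W - N.card) *
      reachProb p (some ⁻¹' R ∪ (N : Set W)) (some ⁻¹' S) ≤
      if N ∈ B.powerset then ((1 - p) ^ B.card) ^ (Fintype.card W - B.card) *
        (p ^ N.card * (1 - p) ^ (Fintype.card W - N.card) * a ^ (B \ (A ∪ N)).card) else 0 := by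
    intro N
    split_ifs with hN
    · have h1 := ih (some ⁻¹' R ∪ (N : Set W)) (some ⁻¹' S)
      rw [hA', hB', ← Finset.coe_union, ← Finset.coe_sdiff, Set.ncard_coe_finset,
        Set.ncard_coe_finset] at h1
      rw [hA', hB', ← Finset.coe_union]
      have h2 : 0 ≤ p ^ N.card * (1 - p) ^ (Fintype.card W - N.card) :=
        mul_nonneg (pow_nonneg hp0 _) (pow_nonneg (by linarith) _)
      calc _ ≤ _ := mul_le_mul_of_nonneg_left h1 h2
        _ = _ := by ring
    -- A neighbour of the deleted root outside `S` would be reached, so these `N` contribute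
    -- nothing.
    · rw [reachProb_of_not_subset, mul_zero]
      intro h
      apply hN
      rw [Finset.mem_powerset, ← Finset.coe_subset, ← hB']
      exact Set.subset_union_right.trans h
  rw [reachProb_option p hR hS]
  refine (Finset.sum_le_sum fun N _ => hterm N).trans ?_
  rw [← Finset.sum_filter, Finset.filter_univ_mem, ← Finset.mul_sum,
    sum_powerset_mul_pow_card_sdiff A B hBw, hScard, hSRcard, Fintype.card_option,
    Nat.add_sub_add_right]
  -- A vertex misses all of `S` when it misses `none` and the rest of `S`; this identity makes the
  -- induction close without loss.
  have h3 : p + (1 - p) * a = 1 - (1 - p) ^ (B.card + 1) := by rw [ha]; ring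
  rw [h3, pow_succ (1 - p) B.card, mul_pow]
  apply le_of_eq
  ring

/-- The exploration bound: the set reached from `R` equals `S` only if every vertex of `S \ R`
receives an edge from `S` and no edge leaves `S`. -/
theorem reachProb_le {p : ℝ} (hp0 : 0 ≤ p) (hp1 : p ≤ 1) {V : Type*} [Fintype V] (R S : Set V) :
    reachProb p R S ≤ (1 - (1 - p) ^ S.ncard) ^ (S \ R).ncard *
      ((1 - p) ^ S.ncard) ^ (Fintype.card V - S.ncard) := by
  classical
  induction hn : Fintype.card V generalizing V with
  | zero =>
    have : IsEmpty V := Fintype.card_eq_zero_iff.1 hn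
    have hR : R = ∅ := Set.eq_empty_of_isEmpty R
    have hS : S = ∅ := Set.eq_empty_of_isEmpty S
    subst hR hS
    simp [reachProb, weight, Nat.card_eq_fintype_card]
  | succ n ih =>
    rcases R.eq_empty_or_nonempty with rfl | ⟨w, hw⟩
    -- Without a root there is nothing to delete; the claimed bound is `1` if `S` is empty, and the
    -- probability is `0` otherwise.
    · rcases S.eq_empty_or_nonempty with rfl | hS
      · have := binomialRandom_real_reachSet_eq (V := V) ⟨p, hp0, hp1⟩ ∅ ∅
        rw [← this]
        exact measureReal_le_one.trans_eq (by simp)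
      · have : reachProb p (∅ : Set V) S = 0 := by
          apply Finset.sum_eq_zero
          intro G _
          rw [if_neg]
          rw [reachSet_empty]
          exact hS.ne_empty.symm
        rw [this]
        have h1 : (1 - p) ^ S.ncard ≤ 1 := pow_le_one₀ (by linarith) (by linarith)
        have h2 : 0 ≤ (1 - p) ^ S.ncard := pow_nonneg (by linarith) _
        exact mul_nonneg (pow_nonneg (by linarith) _) (pow_nonneg h2 _)
    · by_cases hRS : R ⊆ S
      · set e := (Equiv.optionSubtypeNe w).symm
        have hew : e w = none := by simp [e]
        have hcard : Fintype.card { b // b ≠ w } = n := by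
          have := Fintype.card_congr e
          rw [Fintype.card_option] at this
          omega
        rw [← reachProb_image p e R S]
        have := reachProb_le_option hp0 hp1 (W := { b // b ≠ w })
          (fun R S => by rw [hcard]; exact ih R S hcard)
          (R := e '' R) (S := e '' S) (hew ▸ Set.mem_image_of_mem e hw)
          (hew ▸ Set.mem_image_of_mem e (hRS hw))
        rwa [← Set.image_sdiff e.injective, Set.ncard_image_of_injective _ e.injective,
          Set.ncard_image_of_injective _ e.injective, Fintype.card_option, hcard] at this
      · rw [reachProb_of_not_subset p hRS]
        have h1 : (1 - p) ^ S.ncard ≤ 1 := pow_le_one₀ (by linarith) (by linarith)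
        have h2 : 0 ≤ (1 - p) ^ S.ncard := pow_nonneg (by linarith) _
        exact mul_nonneg (pow_nonneg (by linarith) _) (pow_nonneg h2 _)

theorem binomialRandom_real_ncard_reachSet_le [Fintype V] (p : unitInterval) (R : Finset V)
    {k : ℕ} (hk : R.card ≤ k) :
    (binomialRandom V p).real {G | (G.reachSet R).ncard = k} ≤
      (Fintype.card V - R.card).choose (k - R.card) *
        ((1 - (1 - (p : ℝ)) ^ k) ^ (k - R.card) *
          ((1 - (p : ℝ)) ^ k) ^ (Fintype.card V - k)) := by
  classical
  set 𝒯 := Finset.powersetCard (k - R.card) (Finset.univ \ R) with h𝒯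
  have hsub : {G : SimpleGraph V | (G.reachSet R).ncard = k} ⊆
      ⋃ T ∈ 𝒯, {G : SimpleGraph V | G.reachSet R = ((R ∪ T : Finset V) : Set V)} := by
    intro G hG
    simp only [Set.mem_iUnion]
    refine ⟨(G.reachSet R).toFinset \ R, ?_, ?_⟩
    · have hR : R ⊆ (G.reachSet R).toFinset := by
        rw [Set.subset_toFinset]; exact subset_reachSet G R
      rw [h𝒯, Finset.mem_powersetCard]
      refine ⟨Finset.sdiff_subset_sdiff (Finset.subset_univ _) subset_rfl, ?_⟩
      rw [Finset.card_sdiff_of_subset hR, ← Set.ncard_eq_toFinset_card']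
      rw [show (G.reachSet R).ncard = k from hG]
    · have hR := subset_reachSet G R
      simp only [Set.mem_ofPred_eq, Finset.coe_union, Finset.coe_sdiff, Set.coe_toFinset]
      rw [Set.union_sdiff_cancel hR]
  refine (measureReal_mono hsub (measure_ne_top _ _)).trans ((measureReal_biUnion_finset_le _ _).trans ?_)
  have hterm : ∀ T ∈ 𝒯, (binomialRandom V p).real
      {G : SimpleGraph V | G.reachSet R = ((R ∪ T : Finset V) : Set V)} ≤
        (1 - (1 - (p : ℝ)) ^ k) ^ (k - R.card) * ((1 - (p : ℝ)) ^ k) ^ (Fintype.card V - k) := by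
    intro T hT
    obtain ⟨hTR, hTc⟩ := Finset.mem_powersetCard.1 hT
    have hdisj : Disjoint R T := (Finset.subset_sdiff.1 hTR).2.symm
    have h1 := reachProb_le p.2.1 p.2.2 (R : Set V) ((R ∪ T : Finset V) : Set V)
    have h2 : (R ∪ T).card = k := by rw [Finset.card_union_of_disjoint hdisj]; omega
    have h3 : ((R ∪ T) \ R).card = k - R.card := by
      rw [Finset.union_sdiff_cancel_left hdisj, hTc]
    rw [← Finset.coe_sdiff, Set.ncard_coe_finset, Set.ncard_coe_finset, h2, h3] at h1
    rw [binomialRandom_real_reachSet_eq]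
    exact h1
  refine (Finset.sum_le_card_nsmul _ _ _ hterm).trans ?_
  rw [nsmul_eq_mul, h𝒯, Finset.card_powersetCard, Finset.card_sdiff_of_subset (Finset.subset_univ _),
    Finset.card_univ]

/-! ### From reached sets to the largest component -/

lemma reachSet_singleton (G : SimpleGraph V) (v : V) :
    G.reachSet {v} = (G.connectedComponentMk v).supp := by
  ext w
  simp only [reachSet, Set.mem_singleton_iff, exists_eq_left, Set.mem_ofPred_eq,
    ConnectedComponent.mem_supp_iff, ConnectedComponent.eq]
  exact reachable_comm

lemma ncard_reachSet_singleton_le [Finite V] (G : SimpleGraph V) (v : V) :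
    (G.reachSet {v}).ncard ≤ largestComponentCard G := by
  rw [reachSet_singleton]
  exact le_ciSup (f := fun K : G.ConnectedComponent => K.supp.ncard)
    (Set.finite_range _).bddAbove _

lemma largestComponentCard_le_card [Fintype V] (G : SimpleGraph V) :
    largestComponentCard G ≤ Fintype.card V := by
  rcases isEmpty_or_nonempty G.ConnectedComponent with h | h
  · simp [largestComponentCard]
  · exact ciSup_le fun K => by
      rw [← Nat.card_eq_fintype_card]
      exact Set.ncard_le_card _

lemma exists_supp_ncard_eq [Finite V] [Nonempty V] (G : SimpleGraph V) :
    ∃ K : G.ConnectedComponent, K.supp.ncard = largestComponentCard G :=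
  exists_eq_ciSup_of_finite (f := fun K : G.ConnectedComponent => K.supp.ncard)

/-- Double counting: when the largest size is `k`, all `k` vertices of a largest component reach
exactly `k` vertices. -/
lemma mul_binomialRandom_real_largest_eq_le [Fintype V] [Nonempty V] (p : unitInterval) (k : ℕ) :
    k * (binomialRandom V p).real {G | largestComponentCard G = k} ≤
      ∑ v, (binomialRandom V p).real {G | (G.reachSet {v}).ncard = k} := by
  classical
  simp_rw [binomialRandom_real_eq_sum]
  rw [Finset.sum_comm, Finset.mul_sum]
  apply Finset.sum_le_sum
  intro G _
  have hw := weight_nonneg p.2.1 p.2.2 G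
  simp only [Set.mem_ofPred_eq]
  split_ifs with h
  · obtain ⟨K, hK⟩ := exists_supp_ncard_eq G
    have hv : ∀ v ∈ K.supp.toFinset, (G.reachSet {v}).ncard = k := by
      intro v hv
      rw [Set.mem_toFinset, ConnectedComponent.mem_supp_iff] at hv
      rw [reachSet_singleton, hv, hK, h]
    have hc : K.supp.toFinset.card = k := by rw [← Set.ncard_eq_toFinset_card', hK, h]
    rw [← hc, ← nsmul_eq_mul, ← Finset.sum_const]
    refine (Finset.sum_le_sum fun v hv' => ?_).trans
      (Finset.sum_le_univ_sum_of_nonneg fun v => ?_)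
    · rw [if_pos (by rw [hc]; exact hv v hv')]
    · split_ifs <;> simp [hw]
  · rw [mul_zero]
    exact Finset.sum_nonneg fun v _ => by split_ifs <;> simp [hw]

/-- An upper bound for the probability that exactly `k` of `m` vertices are reached from `r`
given ones. -/
noncomputable def reachBound (m : ℕ) (p : ℝ) (r k : ℕ) : ℝ :=
  (m - r).choose (k - r) * ((1 - (1 - p) ^ k) ^ (k - r) * ((1 - p) ^ k) ^ (m - k))

lemma reachBound_nonneg {p : ℝ} (hp0 : 0 ≤ p) (hp1 : p ≤ 1) (m r k : ℕ) :
    0 ≤ reachBound m p r k := by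
  have h1 : (1 - p) ^ k ≤ 1 := pow_le_one₀ (by linarith) (by linarith)
  have h2 : 0 ≤ (1 - p) ^ k := pow_nonneg (by linarith) _
  exact mul_nonneg (Nat.cast_nonneg _)
    (mul_nonneg (pow_nonneg (by linarith) _) (pow_nonneg h2 _))

lemma mul_binomialRandom_real_largest_eq_le_reachBound {m : ℕ} (hm : 0 < m) (p : unitInterval)
    {k : ℕ} (hk : 1 ≤ k) :
    k * (binomialRandom (Fin m) p).real {G | largestComponentCard G = k} ≤
      m * reachBound m p 1 k := by
  have : Nonempty (Fin m) := ⟨⟨0, hm⟩⟩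
  refine (mul_binomialRandom_real_largest_eq_le p k).trans ?_
  refine (Finset.sum_le_card_nsmul _ _ (reachBound m p 1 k) fun v _ => ?_).trans ?_
  · have := binomialRandom_real_ncard_reachSet_le p {v} (k := k) (by simpa)
    simpa [reachBound] using this
  · simp

/-- A new root adds at most one component, hence at most `d` vertices, so the size of the reached
set cannot jump over a window of length `d`. The least `r` at which it is at least `n` works. -/
lemma exists_ncard_reachSet_mem_Ico {m n d : ℕ} (G : SimpleGraph (Fin m)) (hn : 0 < n)
    (hnm : n ≤ m) (hd : largestComponentCard G ≤ d) :
    ∃ r ≤ m, (G.reachSet {v | v.val < r}).ncard ∈ Set.Ico n (n + d) := by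
  classical
  have hex : ∃ r, n ≤ (G.reachSet {v | v.val < r}).ncard := by
    refine ⟨m, ?_⟩
    have : {v : Fin m | v.val < m} = Set.univ := by ext v; simp
    rw [this, Set.univ_subset_iff.1 (subset_reachSet G Set.univ), Set.ncard_univ]
    simpa
  have hle : Nat.find hex ≤ m := by
    apply Nat.find_min'
    have : {v : Fin m | v.val < m} = Set.univ := by ext v; simp
    rw [this, Set.univ_subset_iff.1 (subset_reachSet G Set.univ), Set.ncard_univ]
    simpa
  refine ⟨Nat.find hex, hle, Nat.find_spec hex, ?_⟩
  rcases hr : Nat.find hex with _ | r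
  · have := Nat.find_spec hex
    rw [hr] at this
    simp at this
    omega
  · have hlt : (G.reachSet {v | v.val < r}).ncard < n := by
      have := Nat.find_min hex (m := r) (by omega)
      omega
    have hrm : r < m := by omega
    have : {v : Fin m | v.val < r + 1} = {v | v.val < r} ∪ {⟨r, hrm⟩} := by
      ext v
      simp only [Set.mem_ofPred_eq, Set.mem_union, Set.mem_singleton_iff, Fin.ext_iff]
      omega
    rw [this, reachSet_union]
    have h1 := Set.ncard_union_le (G.reachSet {v | v.val < r}) (G.reachSet {⟨r, hrm⟩})
    have h2 := ncard_reachSet_singleton_le G ⟨r, hrm⟩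
    omega

lemma binomialRandom_real_largest_le {m n d : ℕ} (p : unitInterval) (hn : 0 < n) (hnm : n ≤ m) :
    (binomialRandom (Fin m) p).real {G | largestComponentCard G ≤ d} ≤
      ∑ k ∈ Finset.Ico n (n + d), ∑ r ∈ Finset.range (k + 1), reachBound m p r k := by
  classical
  set R : ℕ → Finset (Fin m) := fun r => Finset.univ.filter (fun v => v.val < r)
  have hR : ∀ r, ((R r : Finset (Fin m)) : Set (Fin m)) = {v | v.val < r} := by
    intro r; ext v; simp [R]
  have hRc : ∀ r ≤ m, (R r).card = r := by
    intro r hr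
    have := Fin.card_filter_val_lt (n := m) (m := r)
    simpa [R, hr] using this
  -- Roots belong to their reached set, so only `r ≤ k` occurs.
  have hsub : {G : SimpleGraph (Fin m) | largestComponentCard G ≤ d} ⊆
      ⋃ k ∈ Finset.Ico n (n + d), ⋃ r ∈ Finset.range (k + 1),
        {G | r ≤ m ∧ (G.reachSet (R r)).ncard = k} := by
    intro G hG
    obtain ⟨r, hr, hk⟩ := exists_ncard_reachSet_mem_Ico G hn hnm hG
    simp only [Set.mem_iUnion, Finset.mem_Ico, Finset.mem_range]
    refine ⟨_, hk, r, ?_, hr, by rw [hR]⟩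
    have := Set.ncard_le_ncard (subset_reachSet G (R r))
    rw [Set.ncard_coe_finset, hRc r hr, hR] at this
    omega
  refine (measureReal_mono hsub (measure_ne_top _ _)).trans
    ((measureReal_biUnion_finset_le _ _).trans (Finset.sum_le_sum fun k _ =>
      (measureReal_biUnion_finset_le _ _).trans (Finset.sum_le_sum fun r hr => ?_)))
  by_cases hrm : r ≤ m
  · have hrk : (R r).card ≤ k := by rw [hRc r hrm]; simp at hr; omega
    have := binomialRandom_real_ncard_reachSet_le p (R r) hrk
    rw [hRc r hrm, Fintype.card_fin] at this
    simpa [hrm, reachBound] using this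
  · simpa [hrm] using reachBound_nonneg p.2.1 p.2.2 m r k

/-! ### Comparison with binomial probabilities -/

/-- The probability that a binomial random variable with parameters `m` and `q` equals `k`. -/
noncomputable def binomialProb (m : ℕ) (q : ℝ) (k : ℕ) : ℝ :=
  m.choose k * (q ^ k * (1 - q) ^ (m - k))

/-- The quotient of the two binomial coefficients is the product of `(k - i) / (m - i)` for `i < r`,
and each factor is at most `k / m`. -/
lemma mul_choose_sub_le {m k r : ℕ} (hr : r ≤ k) (hk : k ≤ m) :
    (m - r).choose (k - r) * m ^ r ≤ m.choose k * k ^ r := by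
  induction r with
  | zero => simp
  | succ r ih =>
    have ih := ih (by omega)
    obtain ⟨a, ha⟩ : ∃ a, m - r = a + 1 := ⟨m - r - 1, by omega⟩
    obtain ⟨b, hb⟩ : ∃ b, k - r = b + 1 := ⟨k - r - 1, by omega⟩
    have ha' : m - (r + 1) = a := by omega
    have hb' : k - (r + 1) = b := by omega
    rw [ha, hb] at ih
    rw [ha', hb']
    have h1 := Nat.add_one_mul_choose_eq a b
    have h2 : (b + 1) * m ≤ k * (a + 1) := by
      have e1 : m = a + 1 + r := by omega
      have e2 : k = b + 1 + r := by omega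
      have : b ≤ a := by omega
      rw [e1, e2]
      nlinarith
    have h3 : (a + 1) * (a.choose b * m ^ (r + 1)) ≤ (a + 1) * (m.choose k * k ^ (r + 1)) := by
      calc (a + 1) * (a.choose b * m ^ (r + 1)) = ((a + 1) * a.choose b) * m ^ r * m := by ring
        _ = ((a + 1).choose (b + 1) * m ^ r) * ((b + 1) * m) := by rw [h1]; ring
        _ ≤ (m.choose k * k ^ r) * (k * (a + 1)) := Nat.mul_le_mul ih h2
        _ = _ := by ring
    exact Nat.le_of_mul_le_mul_left h3 (by omega)

/-- The binomial coefficient loses a factor `(k / m) ^ r`, and `k / m ≤ q` turns this into the `q ^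
r` that the roots lack. The estimate is thus uniform in `r`, but only below `β`. -/
lemma reachBound_le_binomialProb {p : ℝ} (hp1 : p ≤ 1) {m r k : ℕ} (hm : 0 < m)
    (hr : r ≤ k) (hk : k ≤ m) (hq : (k : ℝ) / m ≤ 1 - (1 - p) ^ k) :
    reachBound m p r k ≤ binomialProb m (1 - (1 - p) ^ k) k := by
  have hQ : 0 ≤ (1 - p) ^ k := pow_nonneg (by linarith) _
  have hm' : (0 : ℝ) < m := by exact_mod_cast hm
  set q := 1 - (1 - p) ^ k with hqdef
  have hq0 : 0 ≤ q := le_trans (by positivity) hq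
  have h1 : ((m - r).choose (k - r) : ℝ) ≤ m.choose k * q ^ r := by
    have h : ((m - r).choose (k - r) : ℝ) * m ^ r ≤ m.choose k * k ^ r := by
      exact_mod_cast mul_choose_sub_le hr hk
    have h2 : ((m - r).choose (k - r) : ℝ) ≤ m.choose k * ((k : ℝ) / m) ^ r := by
      rw [div_pow, mul_div_assoc', le_div_iff₀ (by positivity)]
      exact h
    refine h2.trans ?_
    gcongr
  have h3 : (1 - p) ^ k = 1 - q := by rw [hqdef]; ring
  have h4 : 0 ≤ 1 - q := h3 ▸ hQ
  rw [reachBound, binomialProb, ← hqdef, h3]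
  calc _ ≤ (m.choose k * q ^ r) * (q ^ (k - r) * (1 - q) ^ (m - k)) := by gcongr
    _ = m.choose k * ((q ^ r * q ^ (k - r)) * (1 - q) ^ (m - k)) := by ring
    _ = _ := by rw [← pow_add, Nat.add_sub_cancel' hr]

/-- The factor `m / k` from double counting is absorbed by `m * (m - 1).choose (k - 1) = k *
m.choose k`. The division by `q` remains because the single root carries no factor `q`. -/
lemma binomialRandom_real_largest_eq_le {m : ℕ} (p : unitInterval) {k : ℕ} (hk : 1 ≤ k)
    (hkm : k ≤ m) (hq : 0 < 1 - (1 - (p : ℝ)) ^ k) :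
    (binomialRandom (Fin m) p).real {G | largestComponentCard G = k} ≤
      binomialProb m (1 - (1 - (p : ℝ)) ^ k) k / (1 - (1 - (p : ℝ)) ^ k) := by
  have h := mul_binomialRandom_real_largest_eq_le_reachBound (m := m) (by omega) p hk
  set q := 1 - (1 - (p : ℝ)) ^ k with hqdef
  have h3 : (1 - (p : ℝ)) ^ k = 1 - q := by rw [hqdef]; ring
  obtain ⟨a, rfl⟩ : ∃ a, m = a + 1 := ⟨m - 1, by omega⟩
  obtain ⟨b, rfl⟩ : ∃ b, k = b + 1 := ⟨k - 1, by omega⟩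
  have h1 : ((a + 1 : ℕ) : ℝ) * a.choose b = (a + 1).choose (b + 1) * (b + 1 : ℕ) := by
    exact_mod_cast Nat.add_one_mul_choose_eq a b
  rw [le_div_iff₀ hq]
  have hb : (0 : ℝ) < (b + 1 : ℕ) := by positivity
  refine le_of_mul_le_mul_left ?_ hb
  calc ((b + 1 : ℕ) : ℝ) * (_ * q) = (((b + 1 : ℕ) : ℝ) *
        (binomialRandom (Fin (a + 1)) p).real {G | largestComponentCard G = b + 1}) * q := by ring
    _ ≤ (((a + 1 : ℕ) : ℝ) * reachBound (a + 1) p 1 (b + 1)) * q := by gcongr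
    _ = (((a + 1 : ℕ) : ℝ) * a.choose b) * (q ^ b * (1 - q) ^ (a - b) * q) := by
        rw [reachBound, ← hqdef, h3]
        simp only [Nat.add_sub_cancel, Nat.add_sub_add_right]
        ring
    _ = _ := by
        rw [h1, binomialProb, pow_succ q b, Nat.add_sub_add_right]
        ring

/-! ### Large deviation and Stirling estimates -/

lemma pow_le_pow_mul_exp {m k : ℕ} (hm : 0 < m) {x q : ℝ} (hx : 0 ≤ x) (hq : 0 ≤ q)
    (hk : (k : ℝ) = m * x) :
    q ^ k ≤ x ^ k * Real.exp (2 * m * (√x * √q - x)) := by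
  have hm' : (0 : ℝ) < m := by exact_mod_cast hm
  rcases hx.eq_or_lt with rfl | hx
  · have : k = 0 := by simpa using hk
    subst this
    simp
  · have hu : q / x ≤ Real.exp (2 * (√(q / x) - 1)) := by
      have h1 : √(q / x) ≤ Real.exp (√(q / x) - 1) := by
        have := Real.add_one_le_exp (√(q / x) - 1); linarith
      calc q / x = √(q / x) ^ 2 := (Real.sq_sqrt (by positivity)).symm
        _ ≤ Real.exp (√(q / x) - 1) ^ 2 := by gcongr
        _ = _ := by rw [← Real.exp_nat_mul]; norm_num
    have hs : x * √(q / x) = √x * √q := by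
      rw [Real.sqrt_div hq]
      have h2 : 0 < √x := Real.sqrt_pos.2 hx
      have h3 := Real.mul_self_sqrt hx.le
      field_simp
      linear_combination (-√q) * h3
    calc q ^ k = x ^ k * (q / x) ^ k := by rw [← mul_pow, mul_div_cancel₀ _ hx.ne']
      _ ≤ x ^ k * Real.exp (2 * (√(q / x) - 1)) ^ k := by gcongr
      _ = _ := by
        rw [← Real.exp_nat_mul, hk]
        congr 2
        linear_combination 2 * (m : ℝ) * hs

/-- Relative entropy dominates the squared Hellinger distance `(√x - √q) ^ 2 + (√(1 - x) - √(1 - q))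
^ 2`, and each square is at least `(x - q) ^ 2 / 4`. Square roots avoid logarithms at the endpoints.
-/
lemma pow_mul_pow_le_exp {m k : ℕ} (hm : 0 < m) (hk : k ≤ m) {q : ℝ} (hq0 : 0 ≤ q)
    (hq1 : q ≤ 1) :
    q ^ k * (1 - q) ^ (m - k) ≤ ((k : ℝ) / m) ^ k * (1 - (k : ℝ) / m) ^ (m - k) *
      Real.exp (-(m * ((k : ℝ) / m - q) ^ 2 / 2)) := by
  have hm' : (0 : ℝ) < m := by exact_mod_cast hm
  set x : ℝ := (k : ℝ) / m with hx
  have hx0 : 0 ≤ x := by positivity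
  have hx1 : 0 ≤ 1 - x := by
    rw [hx, sub_nonneg, div_le_one hm']; exact_mod_cast hk
  have hkx : (k : ℝ) = m * x := by rw [hx]; field_simp
  have h1 := pow_le_pow_mul_exp hm hx0 hq0 hkx
  have h2 := pow_le_pow_mul_exp (k := m - k) hm hx1 (sub_nonneg.2 hq1)
    (by rw [Nat.cast_sub hk, hkx]; ring)
  refine (mul_le_mul h1 h2 (by have := sub_nonneg.2 hq1; positivity) (by positivity)).trans ?_
  rw [mul_mul_mul_comm, ← Real.exp_add]
  refine mul_le_mul_of_nonneg_left (Real.exp_le_exp.2 ?_) (by positivity)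
  have key : ∀ x q : ℝ, 0 ≤ x → x ≤ 1 → 0 ≤ q → q ≤ 1 → (x - q) ^ 2 ≤ 4 * (√x - √q) ^ 2 := by
    intro x q hx hx1 hq hq1
    have e1 := Real.sq_sqrt hx
    have e2 := Real.sq_sqrt hq
    have e3 : √x + √q ≤ 2 := by
      have := Real.sqrt_le_one.2 hx1
      have := Real.sqrt_le_one.2 hq1
      linarith
    have e4 : 0 ≤ √x + √q := by positivity
    calc (x - q) ^ 2 = (√x - √q) ^ 2 * (√x + √q) ^ 2 := by
          nth_rw 1 [← e1, ← e2]; ring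
      _ ≤ (√x - √q) ^ 2 * 2 ^ 2 := by gcongr
      _ = _ := by ring
  have k1 := key x q hx0 (by linarith) hq0 hq1
  have k2 := key (1 - x) (1 - q) hx1 (by linarith) (by linarith) (by linarith)
  have e1 := Real.sq_sqrt hx0
  have e2 := Real.sq_sqrt hq0
  have e3 := Real.sq_sqrt hx1
  have e4 := Real.sq_sqrt (sub_nonneg.2 hq1)
  have : 2 * (√x * √q - x) + 2 * (√(1 - x) * √(1 - q) - (1 - x)) ≤ -((x - q) ^ 2 / 2) := by
    nlinarith
  nlinarith

lemma binomialProb_le_one {q : ℝ} (hq0 : 0 ≤ q) (hq1 : q ≤ 1) {m k : ℕ} (hk : k ≤ m) :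
    binomialProb m q k ≤ 1 := by
  have h := add_pow q (1 - q) m
  rw [add_sub_cancel, one_pow] at h
  rw [h, binomialProb, mul_comm]
  have h1 : 0 ≤ 1 - q := sub_nonneg.2 hq1
  exact Finset.single_le_sum (f := fun j => q ^ j * (1 - q) ^ (m - j) * (m.choose j : ℝ))
    (fun j _ => by positivity) (Finset.mem_range.2 (by omega))

lemma factorial_le_stirling {n : ℕ} (hn : 0 < n) :
    (n.factorial : ℝ) ≤ Real.exp 1 * √n * (n / Real.exp 1) ^ n := by
  have h := Stirling.stirlingSeq'_antitone (Nat.zero_le (n - 1))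
  simp only [Function.comp_apply, Nat.succ_eq_add_one, Nat.sub_add_cancel hn, zero_add,
    Stirling.stirlingSeq_one] at h
  have hn' : (0 : ℝ) < n := by exact_mod_cast hn
  rw [Stirling.stirlingSeq, div_le_iff₀ (by positivity),
    Real.sqrt_mul (by norm_num)] at h
  refine h.trans (le_of_eq ?_)
  have : 0 < √(2 : ℝ) := by positivity
  field_simp

lemma stirling_le_factorial (n : ℕ) : √n * (n / Real.exp 1) ^ n ≤ (n.factorial : ℝ) := by
  refine le_trans ?_ (Stirling.le_factorial_stirling n)
  gcongr
  have := Real.pi_gt_three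
  nlinarith [(Nat.cast_nonneg n : (0 : ℝ) ≤ n)]

lemma binomialProb_self_le {m k : ℕ} (hk0 : 0 < k) (hk : k < m) :
    binomialProb m ((k : ℝ) / m) k ≤ Real.exp 1 * √m / (√k * √(m - k : ℕ)) := by
  obtain ⟨l, rfl⟩ := Nat.exists_eq_add_of_lt hk
  set j := l + 1 with hj
  rw [show k + l + 1 = k + j by omega, binomialProb, Nat.add_sub_cancel_left,
    Nat.cast_add_choose]
  have hk' : (0 : ℝ) < k := by exact_mod_cast hk0
  have hj' : (0 : ℝ) < j := by rw [hj]; positivity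
  have h1 := factorial_le_stirling (n := k + j) (by omega)
  have h2 := stirling_le_factorial k
  have h3 := stirling_le_factorial j
  have hpos : (0 : ℝ) < (k + j : ℕ) := by positivity
  have hsub : 1 - (k : ℝ) / (k + j : ℕ) = j / (k + j : ℕ) := by
    field_simp; push_cast; ring
  rw [hsub]
  calc _ ≤ (Real.exp 1 * √(k + j : ℕ) * ((k + j : ℕ) / Real.exp 1) ^ (k + j)) /
        ((√k * (k / Real.exp 1) ^ k) * (√j * (j / Real.exp 1) ^ j)) *
        (((k : ℝ) / (k + j : ℕ)) ^ k * ((j : ℝ) / (k + j : ℕ)) ^ j) := by gcongr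
    _ = _ := by
      simp only [div_pow, pow_add]
      have := Real.exp_pos 1
      have : 0 < √(k : ℝ) := by positivity
      have : 0 < √(j : ℝ) := by positivity
      field_simp

lemma binomialProb_le_mul_exp {m k : ℕ} (hm : 0 < m) (hk : k ≤ m) {q : ℝ} (hq0 : 0 ≤ q)
    (hq1 : q ≤ 1) :
    binomialProb m q k ≤ binomialProb m ((k : ℝ) / m) k *
      Real.exp (-(m * ((k : ℝ) / m - q) ^ 2 / 2)) := by
  rw [binomialProb, binomialProb, mul_assoc]
  exact mul_le_mul_of_nonneg_left (pow_mul_pow_le_exp hm hk hq0 hq1) (Nat.cast_nonneg _)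

/-! ### The survival equation -/

lemma one_sub_pow_le_exp {p : ℝ} (hp1 : p ≤ 1) (k : ℕ) :
    (1 - p) ^ k ≤ Real.exp (-(p * k)) := by
  calc (1 - p) ^ k ≤ Real.exp (-p) ^ k := by
        gcongr
        exact Real.one_sub_le_exp_neg p
    _ = _ := by rw [← Real.exp_nat_mul]; congr 1; ring

lemma exp_sub_le_one_sub_pow {p : ℝ} (hp0 : 0 ≤ p) (hp1 : p ≤ 1) (k : ℕ) :
    Real.exp (-(p * k)) - k * p ^ 2 ≤ (1 - p) ^ k := by
  have h1 : Real.exp (-p) * (1 - p ^ 2) ≤ 1 - p := by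
    have h := Real.add_one_le_exp p
    have h2 : Real.exp (-p) * Real.exp p = 1 := by rw [← Real.exp_add]; simp
    calc Real.exp (-p) * (1 - p ^ 2) = Real.exp (-p) * (p + 1) * (1 - p) := by ring
      _ ≤ Real.exp (-p) * Real.exp p * (1 - p) := by
        have : 0 ≤ 1 - p := by linarith
        gcongr
      _ = _ := by rw [h2, one_mul]
  have h3 : 0 ≤ 1 - p ^ 2 := by nlinarith
  have h4 : 1 - (k : ℝ) * p ^ 2 ≤ (1 - p ^ 2) ^ k := by
    have := one_add_mul_le_pow (a := -p ^ 2) (by nlinarith) k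
    calc 1 - (k : ℝ) * p ^ 2 = 1 + k * (-p ^ 2) := by ring
      _ ≤ _ := this
      _ = _ := by ring
  have h5 : Real.exp (-(p * k)) ≤ 1 := Real.exp_le_one_iff.2 (by simp; positivity)
  have h6 : Real.exp (-(p * k)) = Real.exp (-p) ^ k := by
    rw [← Real.exp_nat_mul]; congr 1; ring
  calc Real.exp (-(p * k)) - k * p ^ 2 ≤ Real.exp (-(p * k)) * (1 - k * p ^ 2) := by
        have : 0 ≤ k * p ^ 2 := by positivity
        nlinarith
    _ ≤ Real.exp (-(p * k)) * (1 - p ^ 2) ^ k := by gcongr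
    _ = (Real.exp (-p) * (1 - p ^ 2)) ^ k := by rw [h6, mul_pow]
    _ ≤ _ := by gcongr

lemma strictConcaveOn_survival {θ : ℝ} (hθ : 0 < θ) :
    StrictConcaveOn ℝ Set.univ (fun x : ℝ => 1 - Real.exp (-θ * x) - x) := by
  refine ⟨convex_univ, fun x _ y _ hxy a b ha hb hab => ?_⟩
  have h := strictConvexOn_exp.2 (Set.mem_univ (-θ * x)) (Set.mem_univ (-θ * y))
    (by intro h; exact hxy (mul_left_cancel₀ (by linarith) h)) ha hb hab
  simp only [smul_eq_mul] at h ⊢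
  rw [show a * (-θ * x) + b * (-θ * y) = -θ * (a * x + b * y) by ring] at h
  nlinarith

/-- A strictly concave function that vanishes at `0` and `β` is positive in between. Uniqueness of
`β` follows as well. -/
lemma survival_pos {θ β δ : ℝ} (hθ : 0 < θ) (hβ : 1 - Real.exp (-θ * β) = β) (hδ : 0 < δ)
    (hδβ : δ < β) : 0 < 1 - Real.exp (-θ * δ) - δ := by
  have hβ0 : 0 < β := hδ.trans hδβ
  have hc := (strictConcaveOn_survival hθ).2
  have h := hc (Set.mem_univ 0) (Set.mem_univ β) hβ0.ne
    (a := 1 - δ / β) (b := δ / β) (by rw [sub_pos, div_lt_one hβ0]; exact hδβ) (by positivity)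
    (by ring)
  simp only [smul_eq_mul, mul_zero, Real.exp_zero, zero_add, div_mul_cancel₀ _ hβ0.ne', hβ] at h
  linarith

/-- The function `1 - exp (-θ x) - x` vanishes at least linearly at its positive zero `β`. -/
lemma mul_abs_sub_le_survival {θ β δ x : ℝ} (hθ : 0 < θ) (hβ : 1 - Real.exp (-θ * β) = β)
    (hβ1 : β < 1) (hδ : 0 < δ) (hδβ : δ < β) (hx : δ ≤ x) :
    (1 - Real.exp (-θ * δ) - δ) * (β - x) ≤ 1 - Real.exp (-θ * x) - x ∧ x ≤ β ∨
    1 - Real.exp (-θ * x) - x ≤ (1 - Real.exp (-θ * δ) - δ) * (β - x) ∧ β ≤ x := by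
  have ha := survival_pos hθ hβ hδ hδβ
  set a := 1 - Real.exp (-θ * δ) - δ with hadef
  have hc := (strictConcaveOn_survival hθ).concaveOn.2
  rcases le_total x β with h | h
  · refine Or.inl ⟨?_, h⟩
    have h1 := hc (Set.mem_univ δ) (Set.mem_univ β)
      (a := (β - x) / (β - δ)) (b := (x - δ) / (β - δ))
      (div_nonneg (by linarith) (by linarith)) (div_nonneg (by linarith) (by linarith))
      (by rw [← add_div, div_eq_one_iff_eq (by linarith)]; ring)
    have h0 : β - δ ≠ 0 := by linarith
    simp only [smul_eq_mul] at h1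
    rw [show (β - x) / (β - δ) * δ + (x - δ) / (β - δ) * β = x by field_simp; ring, hβ, sub_self,
      mul_zero, add_zero, ← hadef] at h1
    refine le_trans ?_ h1
    rw [mul_comm]
    -- The chord from `δ` to `β` has slope of size `a / (β - δ)`, which exceeds `a` because `β - δ <
    -- 1`.
    refine mul_le_mul_of_nonneg_right ?_ ha.le
    rw [le_div_iff₀ (by linarith)]
    nlinarith
  · refine Or.inr ⟨?_, h⟩
    have hxδ : 0 < x - δ := by linarith
    have h1 := hc (Set.mem_univ δ) (Set.mem_univ x)
      (a := (x - β) / (x - δ)) (b := (β - δ) / (x - δ))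
      (div_nonneg (by linarith) (by linarith)) (div_nonneg (by linarith) (by linarith))
      (by rw [← add_div, div_eq_one_iff_eq (by linarith)]; ring)
    have h0 : x - δ ≠ 0 := by linarith
    simp only [smul_eq_mul] at h1
    rw [show (x - β) / (x - δ) * δ + (β - δ) / (x - δ) * x = β by field_simp; ring, hβ, sub_self,
      ← hadef, div_mul_eq_mul_div, div_mul_eq_mul_div, ← add_div, div_le_iff₀ hxδ, zero_mul] at h1
    set y := 1 - Real.exp (-θ * x) - x
    have h2 : (β - δ) * y ≤ a * (β - x) := by linarith
    have h3 : y ≤ 0 := by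
      by_contra! h3
      have : 0 < (β - δ) * y := mul_pos (by linarith) h3
      nlinarith
    nlinarith

lemma sq_sub_le_survival_sq {θ β δ x : ℝ} (hθ : 0 < θ) (hβ : 1 - Real.exp (-θ * β) = β)
    (hβ1 : β < 1) (hδ : 0 < δ) (hδβ : δ < β) (hx : δ ≤ x) :
    (1 - Real.exp (-θ * δ) - δ) ^ 2 * (x - β) ^ 2 ≤ (1 - Real.exp (-θ * x) - x) ^ 2 := by
  have ha := survival_pos hθ hβ hδ hδβ
  rw [← mul_pow, sq_le_sq, abs_mul, abs_of_pos ha]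
  rcases mul_abs_sub_le_survival hθ hβ hβ1 hδ hδβ hx with ⟨h1, h2⟩ | ⟨h1, h2⟩
  · rw [abs_of_nonpos (by linarith : x - β ≤ 0)]
    exact le_trans (by linarith) (le_abs_self _)
  · rw [abs_of_nonneg (by linarith : 0 ≤ x - β)]
    exact le_trans (by linarith) (neg_le_abs _)

lemma existsUnique_survival {θ : ℝ} (hθ : 1 < θ) :
    ∃! x : ℝ, 0 < x ∧ 1 - Real.exp (-θ * x) = x := by
  have hθ0 : 0 < θ := by linarith
  have hlog : 0 < Real.log θ := Real.log_pos hθ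
  -- The maximum of `1 - exp (-θ x) - x` is at `log θ / θ`; its value is nonnegative because `log θ
  -- ≤ θ - 1`.
  have hx0 : 0 < Real.log θ / θ := by positivity
  have h0 : 0 ≤ 1 - Real.exp (-θ * (Real.log θ / θ)) - Real.log θ / θ := by
    rw [show -θ * (Real.log θ / θ) = -Real.log θ by field_simp, Real.exp_neg, Real.exp_log hθ0]
    have h := Real.log_le_sub_one_of_pos hθ0
    have h2 : θ * (1 - θ⁻¹ - Real.log θ / θ) = θ - 1 - Real.log θ := by field_simp
    have h3 : 0 ≤ θ * (1 - θ⁻¹ - Real.log θ / θ) := by rw [h2]; linarith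
    exact nonneg_of_mul_nonneg_right h3 hθ0
  have h1 : 1 - Real.exp (-θ * 1) - 1 ≤ 0 := by
    have := Real.exp_pos (-θ * 1); linarith
  have hle : Real.log θ / θ ≤ 1 := by
    rw [div_le_one hθ0]
    have h := Real.log_le_sub_one_of_pos hθ0
    linarith
  obtain ⟨β, hβ, hβ0⟩ := intermediate_value_Icc' hle
    (f := fun x : ℝ => 1 - Real.exp (-θ * x) - x) (by fun_prop) ⟨h1, h0⟩
  have huniq : ∀ x y : ℝ, 0 < x → x < y → 1 - Real.exp (-θ * x) = x →
      1 - Real.exp (-θ * y) = y → False := by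
    intro x y hx hxy h1 h2
    have := survival_pos hθ0 h2 hx hxy
    linarith
  refine ⟨β, ⟨hx0.trans_le hβ.1, by simpa [sub_eq_zero] using hβ0⟩, ?_⟩
  rintro y ⟨hy0, hy⟩
  have hβ' : 1 - Real.exp (-θ * β) = β := by simpa [sub_eq_zero] using hβ0
  rcases lt_trichotomy y β with h | h | h
  · exact (huniq y β hy0 h hy hβ').elim
  · exact h
  · exact (huniq β y (hx0.trans_le hβ.1) h hβ' hy).elim

/-! ### Gaussian sums and polynomial factors -/

lemma sum_pow_le_of_injOn {r : ℝ} (hr0 : 0 ≤ r) (hr1 : r < 1) (T : Finset ℕ) (f : ℕ → ℕ)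
    (hf : Set.InjOn f T) : ∑ k ∈ T, r ^ f k ≤ (1 - r)⁻¹ := by
  classical
  rw [← Finset.sum_image (f := fun j => r ^ j) hf, ← tsum_geometric_of_lt_one hr0 hr1]
  exact (summable_geometric_of_lt_one hr0 hr1).sum_le_tsum _ fun j _ => by positivity

/-- From `(s t) ^ 2 ≥ 2 s t - 1`, the terms are dominated by a geometric series of ratio `exp (-2
s)` on each side of `y`. -/
lemma sum_exp_neg_sq_le {s y : ℝ} (hs0 : 0 < s) (hs1 : s ≤ 1) (hy : 0 ≤ y) (T : Finset ℕ) :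
    ∑ k ∈ T, Real.exp (-(s ^ 2 * ((k : ℝ) - y) ^ 2)) ≤ 3 * Real.exp 1 / s := by
  classical
  set N := ⌊y⌋₊ with hN
  have hN1 : (N : ℝ) ≤ y := Nat.floor_le hy
  have hN2 : y < N + 1 := Nat.lt_floor_add_one y
  set r := Real.exp (-(2 * s)) with hr
  have hr0 : 0 ≤ r := (Real.exp_pos _).le
  have hr1 : (1 + 2 * s) * r ≤ 1 := by
    have h1 := Real.add_one_le_exp (2 * s)
    have h2 : Real.exp (2 * s) * r = 1 := by rw [hr, ← Real.exp_add]; simp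
    nlinarith
  have hr2 : 2 * s / 3 ≤ 1 - r := by nlinarith
  have hr3 : r < 1 := by linarith
  have hinv : (1 - r)⁻¹ ≤ 3 / (2 * s) := by
    rw [inv_le_comm₀ (by linarith) (by positivity), inv_div]; exact hr2
  have hsq : ∀ (k n : ℕ), (n : ℝ) ≤ |(k : ℝ) - y| →
      Real.exp (-(s ^ 2 * ((k : ℝ) - y) ^ 2)) ≤ Real.exp 1 * r ^ n := by
    intro k n hn
    rw [hr, ← Real.exp_nat_mul, ← Real.exp_add, Real.exp_le_exp, ← sq_abs ((k : ℝ) - y)]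
    nlinarith [sq_nonneg (s * |(k : ℝ) - y| - 1)]
  rw [← Finset.sum_filter_add_sum_filter_not T (fun k => k ≤ N)]
  have h1 : ∑ k ∈ T with k ≤ N, Real.exp (-(s ^ 2 * ((k : ℝ) - y) ^ 2)) ≤
      Real.exp 1 * (1 - r)⁻¹ := by
    refine (Finset.sum_le_sum fun k hk => hsq k (N - k) ?_).trans ?_
    · have hkN := (Finset.mem_filter.1 hk).2
      rw [Nat.cast_sub hkN]
      exact le_trans (by linarith) (neg_le_abs _)
    · rw [← Finset.mul_sum]
      refine mul_le_mul_of_nonneg_left (sum_pow_le_of_injOn hr0 hr3 _ _ ?_) (Real.exp_pos _).le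
      intro a ha b hb hab
      have ha' := (Finset.mem_filter.1 ha).2
      have hb' := (Finset.mem_filter.1 hb).2
      have hab' : N - a = N - b := hab
      omega
  have h2 : ∑ k ∈ T with ¬ k ≤ N, Real.exp (-(s ^ 2 * ((k : ℝ) - y) ^ 2)) ≤
      Real.exp 1 * (1 - r)⁻¹ := by
    refine (Finset.sum_le_sum fun k hk => hsq k (k - (N + 1)) ?_).trans ?_
    · have hkN : N + 1 ≤ k := by have := (Finset.mem_filter.1 hk).2; omega
      rw [Nat.cast_sub hkN]
      push_cast
      exact le_trans (by linarith) (le_abs_self _)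
    · rw [← Finset.mul_sum]
      refine mul_le_mul_of_nonneg_left (sum_pow_le_of_injOn hr0 hr3 _ _ ?_) (Real.exp_pos _).le
      intro a ha b hb hab
      have ha' := (Finset.mem_filter.1 ha).2
      have hb' := (Finset.mem_filter.1 hb).2
      have hab' : a - (N + 1) = b - (N + 1) := hab
      omega
  calc _ ≤ Real.exp 1 * (1 - r)⁻¹ + Real.exp 1 * (1 - r)⁻¹ := add_le_add h1 h2
    _ ≤ Real.exp 1 * (3 / (2 * s)) + Real.exp 1 * (3 / (2 * s)) := by gcongr
    _ = _ := by field_simp; ring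

lemma add_one_sq_le_exp {c : ℝ} (hc : 0 < c) (m : ℕ) :
    ((m : ℝ) + 1) ^ 2 ≤ (1 + 1 / c) ^ 2 * Real.exp (2 * c * m) := by
  have h1 : (m : ℝ) + 1 ≤ (1 + 1 / c) * Real.exp (c * m) := by
    have h := Real.add_one_le_exp (c * m)
    calc (m : ℝ) + 1 ≤ (1 + 1 / c) * (c * m + 1) := by
          have : (1 + 1 / c) * (c * m + 1) = c * m + 1 + m + 1 / c := by
            field_simp; ring
          rw [this]
          have : 0 < 1 / c := by positivity
          have : 0 ≤ c * m := by positivity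
          linarith
      _ ≤ _ := by gcongr
  calc ((m : ℝ) + 1) ^ 2 ≤ ((1 + 1 / c) * Real.exp (c * m)) ^ 2 := by gcongr
    _ = _ := by
      rw [mul_pow, ← Real.exp_nat_mul]; congr 2; push_cast; ring

/-! ### Gaussian decay of the binomial probabilities around `β` -/

section

variable {θ β δ p : ℝ} {m k : ℕ}

lemma survival_le_one_sub_pow (hp1 : p ≤ 1) (hp : p = θ / m) :
    1 - Real.exp (-θ * ((k : ℝ) / m)) ≤ 1 - (1 - p) ^ k := by
  have h := one_sub_pow_le_exp hp1 k
  rw [show -θ * ((k : ℝ) / m) = -(p * k) by rw [hp]; ring]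
  linarith

lemma le_one_sub_pow (hθ : 0 < θ) (hβ : 1 - Real.exp (-θ * β) = β) (hδ : 0 < δ) (hδβ : δ < β)
    (hp1 : p ≤ 1) (hp : p = θ / m) (hk : δ ≤ (k : ℝ) / m) :
    δ ≤ 1 - (1 - p) ^ k := by
  refine le_trans ?_ (survival_le_one_sub_pow hp1 hp)
  have h1 := survival_pos hθ hβ hδ hδβ
  have h2 : Real.exp (-θ * ((k : ℝ) / m)) ≤ Real.exp (-θ * δ) := by
    rw [Real.exp_le_exp]; nlinarith
  linarith

lemma div_le_one_sub_pow (hθ : 0 < θ) (hβ : 1 - Real.exp (-θ * β) = β) (hβ1 : β < 1)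
    (hδ : 0 < δ) (hδβ : δ < β) (hp1 : p ≤ 1) (hp : p = θ / m)
    (hk : δ ≤ (k : ℝ) / m) (hkβ : (k : ℝ) / m ≤ β) :
    (k : ℝ) / m ≤ 1 - (1 - p) ^ k := by
  refine le_trans ?_ (survival_le_one_sub_pow hp1 hp)
  have h1 := survival_pos hθ hβ hδ hδβ
  rcases mul_abs_sub_le_survival hθ hβ hβ1 hδ hδβ hk with ⟨h2, -⟩ | ⟨-, h2⟩
  · nlinarith
  · rw [le_antisymm hkβ h2, hβ]

/-- Replacing `(1 - p) ^ k` by `exp (-p k)` costs `v ≤ k p ^ 2 ≤ θ ^ 2 / m`. Since `(u + v) ^ 2 ≥ u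
^ 2 / 2 - v ^ 2` and `m v ^ 2 ≤ θ ^ 4`, this costs half the rate and the factor `exp (θ ^ 4 / 2)`.
-/
lemma exp_neg_sq_sub_le (hθ : 0 < θ) (hβ : 1 - Real.exp (-θ * β) = β) (hβ1 : β < 1)
    (hδ : 0 < δ) (hδβ : δ < β) (hp1 : p ≤ 1) (hm : 0 < m) (hp : p = θ / m) (hkm : k ≤ m)
    (hk : δ ≤ (k : ℝ) / m) :
    Real.exp (-(m * ((k : ℝ) / m - (1 - (1 - p) ^ k)) ^ 2 / 2)) ≤ Real.exp (θ ^ 4 / 2) *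
      Real.exp (-((1 - Real.exp (-θ * δ) - δ) ^ 2 / 4 * (m * ((k : ℝ) / m - β) ^ 2))) := by
  have hm' : (1 : ℝ) ≤ m := by exact_mod_cast hm
  have hp0 : 0 ≤ p := by rw [hp]; positivity
  have h1 := survival_le_one_sub_pow (k := k) hp1 hp
  have h2 := exp_sub_le_one_sub_pow hp0 hp1 k
  rw [show -(p * k) = -θ * ((k : ℝ) / m) by rw [hp]; ring] at h2
  have h3 := sq_sub_le_survival_sq hθ hβ hβ1 hδ hδβ hk
  set x : ℝ := (k : ℝ) / m
  set v := (1 - (1 - p) ^ k) - (1 - Real.exp (-θ * x)) with hv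
  have hv0 : 0 ≤ v := by linarith
  have hv1 : v ≤ θ ^ 2 / m := by
    have h4 : (k : ℝ) * p ^ 2 ≤ m * p ^ 2 := by
      have : (k : ℝ) ≤ m := by exact_mod_cast hkm
      gcongr
    have h5 : m * p ^ 2 = θ ^ 2 / m := by rw [hp]; field_simp
    linarith
  have hv2 : m * v ^ 2 ≤ θ ^ 4 := by
    calc m * v ^ 2 ≤ m * (θ ^ 2 / m) ^ 2 := by gcongr
      _ = θ ^ 4 / m := by field_simp
      _ ≤ θ ^ 4 := div_le_self (by positivity) hm'
  set u := 1 - Real.exp (-θ * x) - x with hu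
  have hxq : x - (1 - (1 - p) ^ k) = -(u + v) := by rw [hu, hv]; ring
  rw [hxq, ← Real.exp_add, Real.exp_le_exp]
  have h6 : u ^ 2 / 2 - v ^ 2 ≤ (-(u + v)) ^ 2 := by nlinarith [sq_nonneg (u + 2 * v)]
  have h7 : m * (u ^ 2 / 2 - v ^ 2) ≤ m * (-(u + v)) ^ 2 := by gcongr
  have h8 : m * ((1 - Real.exp (-θ * δ) - δ) ^ 2 * (x - β) ^ 2) ≤ m * u ^ 2 := by gcongr
  linarith

lemma one_sub_pow_mem (hp0 : 0 ≤ p) (hp1 : p ≤ 1) (k : ℕ) :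
    0 ≤ 1 - (1 - p) ^ k ∧ 1 - (1 - p) ^ k ≤ 1 := by
  have h1 : (1 - p) ^ k ≤ 1 := pow_le_one₀ (by linarith) (by linarith)
  have h2 : 0 ≤ (1 - p) ^ k := pow_nonneg (by linarith) _
  constructor <;> linarith

lemma binomialProb_le_exp (hθ : 0 < θ) (hβ : 1 - Real.exp (-θ * β) = β) (hβ1 : β < 1)
    (hδ : 0 < δ) (hδβ : δ < β) (hp1 : p ≤ 1) (hm : 0 < m) (hp : p = θ / m) (hkm : k ≤ m)
    (hk : δ ≤ (k : ℝ) / m) {B : ℝ} (hB : binomialProb m ((k : ℝ) / m) k ≤ B) :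
    binomialProb m (1 - (1 - p) ^ k) k ≤ B * (Real.exp (θ ^ 4 / 2) *
      Real.exp (-((1 - Real.exp (-θ * δ) - δ) ^ 2 / 4 * (m * ((k : ℝ) / m - β) ^ 2)))) := by
  have hp0 : 0 ≤ p := by rw [hp]; positivity
  obtain ⟨hq0, hq1⟩ := one_sub_pow_mem hp0 hp1 k
  have hx1 : (0 : ℝ) ≤ 1 - (k : ℝ) / m := by
    rw [sub_nonneg]; exact div_le_one_of_le₀ (by exact_mod_cast hkm) (by positivity)
  have hb : 0 ≤ binomialProb m ((k : ℝ) / m) k := by rw [binomialProb]; positivity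
  exact (binomialProb_le_mul_exp hm hkm hq0 hq1).trans (mul_le_mul hB
    (exp_neg_sq_sub_le hθ hβ hβ1 hδ hδβ hp1 hm hp hkm hk) (Real.exp_pos _).le (hb.trans hB))

end

/-! ### The three ranges of component sizes -/

lemma binomialRandom_real_largest_le_floor {θ β δ : ℝ} (hθ : 0 < θ)
    (hβ : 1 - Real.exp (-θ * β) = β) (hβ1 : β < 1) (hδ : 0 < δ) (hδβ : 3 * δ ≤ β) {m : ℕ}
    (hm : 0 < m) (p : unitInterval) (hp : (p : ℝ) = θ / m) :
    (binomialRandom (Fin m) p).real {G | largestComponentCard G ≤ ⌊δ * m⌋₊} ≤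
      ((m : ℝ) + 1) ^ 2 * (Real.exp (θ ^ 4 / 2) *
        Real.exp (-((1 - Real.exp (-θ * δ) - δ) ^ 2 / 4 * (m * δ ^ 2)))) := by
  have hm' : (0 : ℝ) < m := by exact_mod_cast hm
  set n := ⌈δ * m⌉₊ with hn
  set d := ⌊δ * m⌋₊ with hd
  set D := Real.exp (θ ^ 4 / 2) *
    Real.exp (-((1 - Real.exp (-θ * δ) - δ) ^ 2 / 4 * (m * δ ^ 2))) with hD
  have hn0 : 0 < n := Nat.ceil_pos.2 (by positivity)
  have hnm : n ≤ m := Nat.ceil_le.2 (by nlinarith)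
  have hdm : d ≤ m := by
    have : (d : ℝ) ≤ δ * m := Nat.floor_le (by positivity)
    have : (d : ℝ) ≤ m := by nlinarith
    exact_mod_cast this
  have hterm : ∀ k ∈ Finset.Ico n (n + d), ∑ r ∈ Finset.range (k + 1), reachBound m p r k ≤
      (m + 1) * D := by
    intro k hk
    obtain ⟨hk1, hk2⟩ := Finset.mem_Ico.1 hk
    have hkδ : δ ≤ (k : ℝ) / m := by
      rw [le_div_iff₀ hm']; exact Nat.ceil_le.1 hk1
    -- The open right end of the window offsets the rounding up in `n`, so `k / m ≤ 2 * δ` holds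
    -- exactly and `k / m` stays at distance at least `δ` from `β`.
    have hk2δ : (k : ℝ) / m ≤ 2 * δ := by
      rw [div_le_iff₀ hm']
      have e1 : (d : ℝ) ≤ δ * m := Nat.floor_le (by positivity)
      have e2 : (n : ℝ) < δ * m + 1 := Nat.ceil_lt_add_one (by positivity)
      have e3 : (k : ℝ) + 1 ≤ n + d := by exact_mod_cast hk2
      linarith
    have hkm : k ≤ m := by
      have : (k : ℝ) / m ≤ 1 := by linarith
      rw [div_le_one hm'] at this
      exact_mod_cast this
    have hb : ∀ r ∈ Finset.range (k + 1), reachBound m p r k ≤ D := by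
      intro r hr
      have hrk : r ≤ k := by simpa [Nat.lt_succ_iff] using hr
      refine (reachBound_le_binomialProb p.2.2 hm hrk hkm (div_le_one_sub_pow hθ hβ hβ1 hδ
        (by linarith) p.2.2 hp hkδ (by linarith))).trans ?_
      refine (binomialProb_le_exp hθ hβ hβ1 hδ (by linarith) p.2.2 hm hp hkm hkδ
        (binomialProb_le_one (by positivity) (by linarith) hkm)).trans ?_
      rw [one_mul, hD]
      refine mul_le_mul_of_nonneg_left (Real.exp_le_exp.2 (neg_le_neg ?_)) (Real.exp_pos _).le
      have hsq : δ ^ 2 ≤ ((k : ℝ) / m - β) ^ 2 := by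
        rw [← neg_sq ((k : ℝ) / m - β)]
        exact pow_le_pow_left₀ hδ.le (by linarith) 2
      gcongr
    refine (Finset.sum_le_card_nsmul _ _ _ hb).trans ?_
    rw [Finset.card_range, nsmul_eq_mul]
    have : ((k + 1 : ℕ) : ℝ) ≤ m + 1 := by exact_mod_cast Nat.succ_le_succ hkm
    gcongr
  refine (binomialRandom_real_largest_le p hn0 hnm).trans
    ((Finset.sum_le_card_nsmul _ _ _ hterm).trans ?_)
  rw [Nat.card_Ico, nsmul_eq_mul, Nat.add_sub_cancel_left, pow_two, mul_assoc]
  have : (d : ℝ) ≤ m + 1 := by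
    have : (d : ℝ) ≤ m := by exact_mod_cast hdm
    linarith
  gcongr

lemma binomialRandom_real_largest_eq_le_exp {θ β δ : ℝ} (hθ : 0 < θ)
    (hβ : 1 - Real.exp (-θ * β) = β) (hβ1 : β < 1) (hδ : 0 < δ) (hδβ : δ < β) {m k : ℕ}
    (hm : 0 < m) (p : unitInterval) (hp : (p : ℝ) = θ / m) (hkm : k ≤ m)
    (hk : δ ≤ (k : ℝ) / m) {B : ℝ} (hB : binomialProb m ((k : ℝ) / m) k ≤ B) :
    (binomialRandom (Fin m) p).real {G | largestComponentCard G = k} ≤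
      B * (Real.exp (θ ^ 4 / 2) * Real.exp
        (-((1 - Real.exp (-θ * δ) - δ) ^ 2 / 4 * (m * ((k : ℝ) / m - β) ^ 2)))) / δ := by
  have hm' : (0 : ℝ) < m := by exact_mod_cast hm
  have hk1 : 1 ≤ k := by
    rw [Nat.one_le_iff_ne_zero]
    rintro rfl
    simp at hk
    linarith
  have hq := le_one_sub_pow hθ hβ hδ hδβ p.2.2 hp hk
  obtain ⟨hq0, hq1⟩ := one_sub_pow_mem p.2.1 p.2.2 k
  have h1 := binomialProb_le_exp hθ hβ hβ1 hδ hδβ p.2.2 hm hp hkm hk hB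
  refine (binomialRandom_real_largest_eq_le p hk1 hkm (by linarith)).trans ?_
  have h2 : 0 ≤ binomialProb m (1 - (1 - (p : ℝ)) ^ k) k := by
    have := sub_nonneg.2 hq1
    rw [binomialProb]
    positivity
  exact div_le_div₀ (h2.trans h1) h1 hδ hq

lemma sq_mul_le_mul_sq_div_sub {A β : ℝ} {m k : ℕ} (hA : 0 < A) (hm : 0 < m)
    (h : A * √m ≤ |(k : ℝ) - β * m|) : A ^ 2 ≤ m * ((k : ℝ) / m - β) ^ 2 := by
  have hm' : (0 : ℝ) < m := by exact_mod_cast hm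
  have h1 : (A * √m) ^ 2 ≤ |(k : ℝ) - β * m| ^ 2 := pow_le_pow_left₀ (by positivity) h 2
  rw [sq_abs, mul_pow, Real.sq_sqrt hm'.le] at h1
  have h2 : m * ((k : ℝ) / m - β) ^ 2 = ((k : ℝ) - β * m) ^ 2 / m := by field_simp
  rw [h2, le_div_iff₀ hm']
  exact h1

/-- Half of the Gaussian exponent yields the decay in `A`. The other half is summed over `k` and
gives a factor of order `√m`, which cancels Stirling's `1 / √m`; the latter needs `k / m` away from
`0` and `1`. -/
lemma sum_largest_eq_le_of_le {θ β δ η A : ℝ} (hθ : 0 < θ)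
    (hβ : 1 - Real.exp (-θ * β) = β) (hβ1 : β < 1) (hδ : 0 < δ) (hδβ : δ < β) (hη : 0 < η)
    (hA : 0 < A) {m : ℕ} (hm : 0 < m) (p : unitInterval) (hp : (p : ℝ) = θ / m) (T : Finset ℕ)
    (hT : ∀ k ∈ T, k ≤ m ∧ δ ≤ (k : ℝ) / m ∧ (k : ℝ) / m ≤ 1 - η ∧ A * √m ≤ |(k : ℝ) - β * m|) :
    ∑ k ∈ T, (binomialRandom (Fin m) p).real {G | largestComponentCard G = k} ≤
      Real.exp 1 / (√δ * √η) * Real.exp (θ ^ 4 / 2) / δ *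
        (3 * Real.exp 1 / √((1 - Real.exp (-θ * δ) - δ) ^ 2 / 8)) *
        Real.exp (-((1 - Real.exp (-θ * δ) - δ) ^ 2 / 8 * A ^ 2)) := by
  have hm' : (0 : ℝ) < m := by exact_mod_cast hm
  have ha := survival_pos hθ hβ hδ hδβ
  have ha1 : 1 - Real.exp (-θ * δ) - δ ≤ 1 := by
    have := Real.exp_pos (-θ * δ); linarith
  set g := (1 - Real.exp (-θ * δ) - δ) ^ 2 / 8 with hg
  have hg0 : 0 < g := by positivity
  have hg1 : g ≤ 1 := by rw [hg]; nlinarith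
  have hgg : (1 - Real.exp (-θ * δ) - δ) ^ 2 / 4 = 2 * g := by rw [hg]; ring
  set s := √g / √m with hs
  have hs0 : 0 < s := by positivity
  have hs1 : s ≤ 1 := by
    rw [hs, div_le_one (by positivity)]
    apply Real.sqrt_le_sqrt
    have : (1 : ℝ) ≤ m := by exact_mod_cast hm
    linarith
  have hs2 : s ^ 2 = g / m := by rw [hs, div_pow, Real.sq_sqrt hg0.le, Real.sq_sqrt hm'.le]
  set K := Real.exp 1 / (√δ * √η * √m) * Real.exp (θ ^ 4 / 2) / δ * Real.exp (-(g * A ^ 2)) with hK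
  have hterm : ∀ k ∈ T, (binomialRandom (Fin m) p).real {G | largestComponentCard G = k} ≤
      K * Real.exp (-(s ^ 2 * ((k : ℝ) - β * m) ^ 2)) := by
    intro k hk
    obtain ⟨hkm, hkδ, hkη, hkA⟩ := hT k hk
    have hδm : δ * m ≤ k := by rwa [le_div_iff₀ hm'] at hkδ
    have hηm : η * m ≤ (m - k : ℕ) := by
      rw [Nat.cast_sub hkm]
      rw [div_le_iff₀ hm'] at hkη
      linarith
    have hk0 : 0 < k := by
      have : (0 : ℝ) < k := lt_of_lt_of_le (by positivity) hδm
      exact_mod_cast this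
    have hklt : k < m := by
      have : (0 : ℝ) < (m - k : ℕ) := lt_of_lt_of_le (by positivity) hηm
      have : 0 < m - k := by exact_mod_cast this
      omega
    have hB : binomialProb m ((k : ℝ) / m) k ≤ Real.exp 1 / (√δ * √η * √m) := by
      refine (binomialProb_self_le hk0 hklt).trans ?_
      have e1 : √δ * √m ≤ √k := by
        rw [← Real.sqrt_mul hδ.le]; exact Real.sqrt_le_sqrt hδm
      have e2 : √η * √m ≤ √(m - k : ℕ) := by
        rw [← Real.sqrt_mul hη.le]; exact Real.sqrt_le_sqrt hηm
      calc _ ≤ Real.exp 1 * √m / ((√δ * √m) * (√η * √m)) := by gcongr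
        _ = _ := by
          have : 0 < √(m : ℝ) := by positivity
          field_simp
    refine (binomialRandom_real_largest_eq_le_exp hθ hβ hβ1 hδ hδβ hm p hp hkm hkδ hB).trans ?_
    have hx := sq_mul_le_mul_sq_div_sub hA hm hkA
    have hx2 : s ^ 2 * ((k : ℝ) - β * m) ^ 2 = g * (m * ((k : ℝ) / m - β) ^ 2) := by
      rw [hs2]; field_simp
    rw [hx2, hgg, hK]
    have hexp : Real.exp (-(2 * g * (m * ((k : ℝ) / m - β) ^ 2))) ≤
        Real.exp (-(g * A ^ 2)) * Real.exp (-(g * (m * ((k : ℝ) / m - β) ^ 2))) := by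
      rw [← Real.exp_add, Real.exp_le_exp]
      nlinarith
    calc _ ≤ Real.exp 1 / (√δ * √η * √m) * (Real.exp (θ ^ 4 / 2) *
          (Real.exp (-(g * A ^ 2)) * Real.exp (-(g * (m * ((k : ℝ) / m - β) ^ 2))))) / δ := by
          gcongr
      _ = _ := by ring
  refine (Finset.sum_le_sum hterm).trans ?_
  rw [← Finset.mul_sum]
  refine (mul_le_mul_of_nonneg_left (sum_exp_neg_sq_le hs0 hs1
    (y := β * m) (by have := hδ.trans hδβ; positivity) T) (by positivity)).trans (le_of_eq ?_)
  rw [hK, hs]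
  have : 0 < √(m : ℝ) := by positivity
  have : 0 < √g := by positivity
  have : 0 < √δ := by positivity
  have : 0 < √η := by positivity
  field_simp

/-- Stirling's bound degenerates near `k = m`, but there `k / m - β ≥ η`, so bounding binomial
probabilities by `1` suffices. The square in the prefactor only matches the form used for small
components. -/
lemma sum_largest_eq_le_of_ge {θ β δ η : ℝ} (hθ : 0 < θ)
    (hβ : 1 - Real.exp (-θ * β) = β) (hβ1 : β < 1) (hδ : 0 < δ) (hδβ : δ < β) (hη : 0 < η)
    (hηβ : β + η ≤ 1 - η) {m : ℕ} (hm : 0 < m) (p : unitInterval) (hp : (p : ℝ) = θ / m)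
    (T : Finset ℕ) (hT : ∀ k ∈ T, k ≤ m ∧ 1 - η ≤ (k : ℝ) / m) :
    ∑ k ∈ T, (binomialRandom (Fin m) p).real {G | largestComponentCard G = k} ≤
      ((m : ℝ) + 1) ^ 2 * (Real.exp (θ ^ 4 / 2) *
        Real.exp (-((1 - Real.exp (-θ * δ) - δ) ^ 2 / 4 * (m * η ^ 2))) / δ) := by
  have hm' : (0 : ℝ) < m := by exact_mod_cast hm
  set D := Real.exp (θ ^ 4 / 2) *
        Real.exp (-((1 - Real.exp (-θ * δ) - δ) ^ 2 / 4 * (m * η ^ 2))) / δ with hD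
  have hterm : ∀ k ∈ T, (binomialRandom (Fin m) p).real {G | largestComponentCard G = k} ≤ D := by
    intro k hk
    obtain ⟨hkm, hkη⟩ := hT k hk
    have hx1 : (k : ℝ) / m ≤ 1 := div_le_one_of_le₀ (by exact_mod_cast hkm) hm'.le
    refine (binomialRandom_real_largest_eq_le_exp hθ hβ hβ1 hδ hδβ hm p hp hkm (by linarith)
      (binomialProb_le_one (by positivity) hx1 hkm)).trans ?_
    rw [one_mul, hD]
    have hsq : η ^ 2 ≤ ((k : ℝ) / m - β) ^ 2 := pow_le_pow_left₀ hη.le (by linarith) 2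
    gcongr
  have hcard : (T.card : ℝ) ≤ (m + 1) ^ 2 := by
    have h1 : T ⊆ Finset.range (m + 1) := fun k hk => by
      have := (hT k hk).1
      simp; omega
    have h2 := Finset.card_le_card h1
    rw [Finset.card_range] at h2
    have h3 : (T.card : ℝ) ≤ m + 1 := by exact_mod_cast h2
    nlinarith
  refine (Finset.sum_le_card_nsmul _ _ _ hterm).trans ?_
  rw [nsmul_eq_mul]
  gcongr

/-! ### Assembling the tail bound -/

/-- Quadratic prefactors are absorbed by halving the rate of exponential decay. -/
lemma add_one_sq_mul_exp_le {b : ℝ} (hb : 0 < b) (m : ℕ) :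
    ((m : ℝ) + 1) ^ 2 * Real.exp (-(b * m)) ≤ (1 + 4 / b) ^ 2 * Real.exp (-(b / 2 * m)) := by
  have h := add_one_sq_le_exp (c := b / 4) (by positivity) m
  calc _ ≤ ((1 + 1 / (b / 4)) ^ 2 * Real.exp (2 * (b / 4) * m)) * Real.exp (-(b * m)) := by gcongr
    _ = _ := by
      rw [mul_assoc, ← Real.exp_add, one_div_div]
      congr 2
      ring

lemma add_one_sq_mul_mul_exp_le {b c t B : ℝ} (hb : 0 < b) (hc : 0 ≤ c) (hcb : c ≤ b / 2)
    (hB : 0 ≤ B) {m : ℕ} (ht : t ≤ m) :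
    ((m : ℝ) + 1) ^ 2 * (B * Real.exp (-(b * m))) ≤
      B * (1 + 4 / b) ^ 2 * Real.exp (-c * t) := by
  have h : Real.exp (-(b / 2 * m)) ≤ Real.exp (-c * t) := by
    rw [Real.exp_le_exp]
    have h1 : c * t ≤ c * m := mul_le_mul_of_nonneg_left ht hc
    have h2 : c * m ≤ b / 2 * m := mul_le_mul_of_nonneg_right hcb (Nat.cast_nonneg m)
    linarith
  calc _ = B * (((m : ℝ) + 1) ^ 2 * Real.exp (-(b * m))) := by ring
    _ ≤ B * ((1 + 4 / b) ^ 2 * Real.exp (-(b / 2 * m))) :=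
        mul_le_mul_of_nonneg_left (add_one_sq_mul_exp_le hb m) hB
    _ ≤ B * ((1 + 4 / b) ^ 2 * Real.exp (-c * t)) :=
        mul_le_mul_of_nonneg_left (mul_le_mul_of_nonneg_left h (sq_nonneg _)) hB
    _ = _ := by ring

theorem exists_largestComponent_tail_le {θ β : ℝ} (hθ : 0 < θ) (hβ0 : 0 < β)
    (hβ : 1 - Real.exp (-θ * β) = β) :
    ∃ K c : ℝ, 0 < K ∧ 0 < c ∧ ∀ m : ℕ, 0 < m → ∀ p : unitInterval, (p : ℝ) = θ / m →
      ∀ A : ℝ, 0 < A → A ^ 2 ≤ m →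
        (binomialRandom (Fin m) p).real
          {G | A * √m ≤ |(largestComponentCard G : ℝ) - β * m|} ≤ K * Real.exp (-c * A ^ 2) := by
  classical
  have hβ1 : β < 1 := by
    have := Real.exp_pos (-θ * β); linarith
  -- With `β / 3` the window up to `2 * δ` stays below `β` by `δ`; with `(1 - β) / 2` the point `1 -
  -- η` is the midpoint of `β` and `1`.
  set δ := β / 3 with hδdef
  set η := (1 - β) / 2 with hηdef
  have hδ : 0 < δ := by positivity
  have hη : 0 < η := by rw [hηdef]; linarith
  have hδβ : δ < β := by rw [hδdef]; linarith
  have ha := survival_pos hθ hβ hδ hδβ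
  set a := 1 - Real.exp (-θ * δ) - δ with hadef
  set E := Real.exp (θ ^ 4 / 2) with hE
  have hE0 : 0 < E := Real.exp_pos _
  set K₁ := Real.exp 1 / (√δ * √η) * E / δ * (3 * Real.exp 1 / √(a ^ 2 / 8)) with hK₁
  set b₂ := a ^ 2 / 4 * δ ^ 2 with hb₂
  set b₃ := a ^ 2 / 4 * η ^ 2 with hb₃
  have hb₂0 : 0 < b₂ := by positivity
  have hb₃0 : 0 < b₃ := by positivity
  have hK₁0 : 0 < K₁ := by positivity
  set K₂ := E * (1 + 4 / b₂) ^ 2 with hK₂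
  set K₃ := E / δ * (1 + 4 / b₃) ^ 2 with hK₃
  have hK₂0 : 0 < K₂ := by positivity
  have hK₃0 : 0 < K₃ := by positivity
  set c := min (a ^ 2 / 8) (min (b₂ / 2) (b₃ / 2)) with hc
  have hc1 : c ≤ a ^ 2 / 8 := min_le_left _ _
  have hc2 : c ≤ b₂ / 2 := (min_le_right _ _).trans (min_le_left _ _)
  have hc3 : c ≤ b₃ / 2 := (min_le_right _ _).trans (min_le_right _ _)
  have hc0 : 0 < c := lt_min (by positivity) (lt_min (by positivity) (by positivity))
  refine ⟨K₁ + K₂ + K₃, c, by positivity, hc0, fun m hm p hp A hA hAm => ?_⟩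
  have hm' : (0 : ℝ) < m := by exact_mod_cast hm
  set d := ⌊δ * m⌋₊ with hd
  set T := (Finset.range (m + 1)).filter
    (fun k : ℕ => d < k ∧ A * √m ≤ |(k : ℝ) - β * m|) with hT
  set T₁ := T.filter (fun k : ℕ => (k : ℝ) / m ≤ 1 - η) with hT₁
  set T₂ := T.filter (fun k : ℕ => ¬ (k : ℝ) / m ≤ 1 - η) with hT₂
  have hTmem : ∀ k ∈ T, k ≤ m ∧ δ ≤ (k : ℝ) / m ∧ A * √m ≤ |(k : ℝ) - β * m| := by
    intro k hk
    obtain ⟨h1, h2, h3⟩ := Finset.mem_filter.1 hk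
    refine ⟨by simpa [Nat.lt_succ_iff] using h1, ?_, h3⟩
    rw [le_div_iff₀ hm']
    exact (Nat.lt_of_floor_lt h2).le
  have hsub : {G : SimpleGraph (Fin m) | A * √m ≤ |(largestComponentCard G : ℝ) - β * m|} ⊆
      {G | largestComponentCard G ≤ d} ∪ ⋃ k ∈ T, {G | largestComponentCard G = k} := by
    intro G hG
    by_cases h : largestComponentCard G ≤ d
    · exact Or.inl h
    · refine Or.inr ?_
      simp only [Set.mem_iUnion]
      refine ⟨largestComponentCard G, ?_, rfl⟩
      have := largestComponentCard_le_card G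
      rw [Fintype.card_fin] at this
      exact Finset.mem_filter.2 ⟨Finset.mem_range.2 (by omega), by omega, hG⟩
  have h0 : (binomialRandom (Fin m) p).real
      {G | A * √m ≤ |(largestComponentCard G : ℝ) - β * m|} ≤
      (binomialRandom (Fin m) p).real {G | largestComponentCard G ≤ d} +
        (∑ k ∈ T₁, (binomialRandom (Fin m) p).real {G | largestComponentCard G = k} +
          ∑ k ∈ T₂, (binomialRandom (Fin m) p).real {G | largestComponentCard G = k}) := by
    rw [hT₁, hT₂, Finset.sum_filter_add_sum_filter_not]
    exact (measureReal_mono hsub (measure_ne_top _ _)).trans ((measureReal_union_le _ _).trans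
      (add_le_add le_rfl (measureReal_biUnion_finset_le _ _)))
  have hexp : ∀ e : ℝ, c ≤ e → Real.exp (-(e * A ^ 2)) ≤ Real.exp (-c * A ^ 2) := by
    intro e he
    rw [Real.exp_le_exp]
    nlinarith [sq_nonneg A]
  have h1 : ∑ k ∈ T₁, (binomialRandom (Fin m) p).real {G | largestComponentCard G = k} ≤
      K₁ * Real.exp (-c * A ^ 2) := by
    refine (sum_largest_eq_le_of_le hθ hβ hβ1 hδ hδβ hη hA hm p hp T₁ fun k hk => ?_).trans ?_
    · obtain ⟨hk1, hk2⟩ := Finset.mem_filter.1 hk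
      obtain ⟨e1, e2, e3⟩ := hTmem k hk1
      exact ⟨e1, e2, hk2, e3⟩
    · exact mul_le_mul_of_nonneg_left (hexp _ hc1) hK₁0.le
  have h2 : (binomialRandom (Fin m) p).real {G | largestComponentCard G ≤ d} ≤
      K₂ * Real.exp (-c * A ^ 2) := by
    refine (binomialRandom_real_largest_le_floor hθ hβ hβ1 hδ (by linarith) hm p hp).trans ?_
    rw [show a ^ 2 / 4 * (m * δ ^ 2) = b₂ * m by rw [hb₂]; ring]
    exact add_one_sq_mul_mul_exp_le hb₂0 hc0.le hc2 hE0.le hAm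
  have h3 : ∑ k ∈ T₂, (binomialRandom (Fin m) p).real {G | largestComponentCard G = k} ≤
      K₃ * Real.exp (-c * A ^ 2) := by
    refine (sum_largest_eq_le_of_ge hθ hβ hβ1 hδ hδβ hη (by rw [hηdef]; linarith) hm p hp T₂
      fun k hk => ?_).trans ?_
    · obtain ⟨hk1, hk2⟩ := Finset.mem_filter.1 hk
      exact ⟨(hTmem k hk1).1, (not_le.1 hk2).le⟩
    · rw [show a ^ 2 / 4 * (m * η ^ 2) = b₃ * m by rw [hb₃]; ring, mul_div_right_comm]
      exact add_one_sq_mul_mul_exp_le hb₃0 hc0.le hc3 (by positivity) hAm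
  calc _ ≤ _ := h0
    _ ≤ K₂ * Real.exp (-c * A ^ 2) +
        (K₁ * Real.exp (-c * A ^ 2) + K₃ * Real.exp (-c * A ^ 2)) :=
      add_le_add h2 (add_le_add h1 h3)
    _ = _ := by ring

/-- A number in `[0, 1]` is at most its power with exponent `s ≤ 1`. The choice of `s` brings `(K +
1) ^ s` down to at most `exp (1 / 2) ≤ 2`, while the rate becomes `s * c`; this makes the prefactor
universal. -/
lemma le_two_mul_exp_of_le {K c : ℝ} (hK : 0 < K) (hc : 0 < c) :
    ∃ c' : ℝ, 0 < c' ∧ ∀ x t : ℝ, 0 ≤ x → x ≤ 1 → 0 ≤ t → x ≤ K * Real.exp (-c * t) →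
      x ≤ 2 * Real.exp (-c' * t) := by
  have hl : 0 ≤ Real.log (K + 1) := Real.log_nonneg (by linarith)
  set s := 1 / (2 * (Real.log (K + 1) + 1)) with hs
  have hs0 : 0 < s := by positivity
  have hs1 : s ≤ 1 := by
    rw [hs, div_le_one (by positivity)]; linarith
  refine ⟨s * c, by positivity, fun x t hx0 hx1 ht hx => ?_⟩
  have hx' : x ≤ Real.exp (Real.log (K + 1) - c * t) := by
    refine hx.trans ?_
    rw [sub_eq_add_neg, Real.exp_add, Real.exp_log (by linarith), ← neg_mul]
    gcongr
    linarith
  have hsl : s * Real.log (K + 1) ≤ 1 / 2 := by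
    rw [hs, div_mul_eq_mul_div, div_le_div_iff₀ (by positivity) (by norm_num)]
    linarith
  have h2 : Real.exp (1 / 2) ≤ 2 := by
    have h := Real.exp_one_lt_d9
    have h3 : Real.exp (1 / 2) ^ 2 = Real.exp 1 := by rw [← Real.exp_nat_mul]; norm_num
    have h4 := Real.exp_pos (1 / 2 : ℝ)
    nlinarith
  calc x ≤ Real.exp (s * (Real.log (K + 1) - c * t)) := by
        rcases le_total 0 (Real.log (K + 1) - c * t) with h | h
        · exact hx1.trans (Real.one_le_exp (by positivity))
        · refine hx'.trans (Real.exp_le_exp.2 ?_)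
          nlinarith
    _ ≤ Real.exp (1 / 2 + -(s * c) * t) := by
        rw [Real.exp_le_exp]; nlinarith
    _ ≤ _ := by rw [Real.exp_add]; gcongr

end SimpleGraph

theorem mainTheorem5 :
    ∃ C : ℝ, 0 < C ∧ ∀ θ : ℝ, 1 < θ →
      (∃! x : ℝ, 0 < x ∧ 1 - Real.exp (-θ * x) = x) ∧
      ∀ β : ℝ, 0 < β → 1 - Real.exp (-θ * β) = β →
        ∃ c : ℝ, 0 < c ∧
          ∀ m : ℕ, 0 < m → ∀ p : unitInterval, (p : ℝ) = θ / (m : ℝ) →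
            ∀ A : ℝ, 0 < A →
              (SimpleGraph.binomialRandom (Fin m) p).real
                  {G : SimpleGraph (Fin m) |
                    A * Real.sqrt m ≤ |(largestComponentCard G : ℝ) - β * m|}
                ≤ C * Real.exp (-c * A ^ 2) := by
  refine ⟨2, by norm_num, fun θ hθ => ⟨SimpleGraph.existsUnique_survival hθ, fun β hβ0 hβ => ?_⟩⟩
  have hβ1 : β < 1 := by
    have := Real.exp_pos (-θ * β); linarith
  obtain ⟨K, c, hK, hc, h⟩ :=
    SimpleGraph.exists_largestComponent_tail_le (by linarith : 0 < θ) hβ0 hβ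
  obtain ⟨c', hc', h'⟩ := SimpleGraph.le_two_mul_exp_of_le hK hc
  refine ⟨c', hc', fun m hm p hp A hA => ?_⟩
  have hm' : (0 : ℝ) < m := by exact_mod_cast hm
  -- Decay in `m` is decay in `A ^ 2` only while `A ^ 2 ≤ m`. Beyond that the event is empty, as the
  -- deviation never exceeds `m < A * √m`.
  rcases le_or_gt (A ^ 2) (m : ℝ) with hAm | hAm
  · exact h' _ _ measureReal_nonneg measureReal_le_one (sq_nonneg A) (h m hm p hp A hA hAm)
  · have hempty : {G : SimpleGraph (Fin m) |
        A * Real.sqrt m ≤ |(largestComponentCard G : ℝ) - β * m|} = ∅ := by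
      rw [Set.eq_empty_iff_forall_notMem]
      intro G hG
      have h1 : (largestComponentCard G : ℝ) ≤ m := by
        have := SimpleGraph.largestComponentCard_le_card G
        rw [Fintype.card_fin] at this
        exact_mod_cast this
      have h2 : (0 : ℝ) ≤ largestComponentCard G := Nat.cast_nonneg _
      have h3 : |(largestComponentCard G : ℝ) - β * m| ≤ m := by
        rw [abs_le]; constructor <;> nlinarith
      have h4 : Real.sqrt m < A := (Real.sqrt_lt' hA).2 hAm
      have h5 : (m : ℝ) < A * Real.sqrt m := by
        calc (m : ℝ) = Real.sqrt m * Real.sqrt m := (Real.mul_self_sqrt hm'.le).symm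
          _ < _ := by gcongr
      have h6 : A * Real.sqrt m ≤ |(largestComponentCard G : ℝ) - β * m| := hG
      linarith
    rw [hempty, measureReal_empty]
    positivity
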